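/- Let $\zeta\colon Z\to M$ be an AV-bundle over a smooth (finite-dimensional, Hausdorff, second countable) manifold $M$, i.e. a smooth affine line bundle whose model bundle is identified with $M\times\mathbb R$ (equivalently, a principal $(\mathbb R,+)$-bundle). Let $X_Z$ be minus the generator of $z\mapsto z+r$ ($X_Z=-\partial_s$ in local affine coordinates $(x^a,s)$). For points $a,a'$ of a fibre put $F_a(a')=a-a'$; for a section $\sigma$ put $F_\sigma(z)=\sigma(\zeta(z))-z$, and for $f\in C^\infty(M)$ put $F_f=f\circ\zeta$. Let $Pol^n(Z)=\{f\in C^\infty(Z): X_Z^{n+1}f=0\}$, let $\mathcal D^1_{ah}(Z)$ be the space of first-order operators $D=X+h$ ($X$ a smooth vector field, $h$ a smooth function on $Z$) with $D(Pol^n(Z))\subset Pol^n(Z)$ for all $n$, and let $\mathcal X_{ah}(Z)$ be the set of vector fields in $\mathcal D^1_{ah}(Z)$, $\widetilde{\mathcal X}(Z)$ the set of vector fields $X$ on $Z$ with $[X_Z,X]=0$. Let $\widetilde{\mathsf T}Z=TZ/\mathbb R$, let $Z^\dagger_m$ be the space of affine functions on $Z_m$, let $\mathbf D_\psi=\psi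 X_Z-X_Z(\psi)$, and let $\mathsf RZ$ be the special direct sum $\widetilde{\mathsf T}Z\oplus Z^\dagger\oplus Z^\dagger$ (the distinguished sections $X_Z$, $1$, $1$ being identified), where the class of $(X,\varphi,\psi)$ is regarded as the operator $X+\varphi X_Z+\mathbf D_\psi$ along the fibres. Then $\mathsf RZ$ is a smooth vector bundle over $M$ with $\mathrm{Sec}(\mathsf RZ)=\mathcal D^1_{ah}(Z)$. Write $[\cdot,\cdot]$ for the commutator of operators (the Lie algebroid bracket of $\mathsf RZ$). Let $\varphi^0$ be the section of $\mathsf RZ^*$ uniquely determined by $[R,X_Z]=\langle\varphi^0,R\rangle X_Z$ for $R\in\mathrm{Sec}(\mathsf RZ)$, and $\varphi^1$ the smooth section given by $\langle\varphi^1,X+\gamma\rangle=\gamma$ for a vector field $X$ and a basic function $\gamma$. In $\mathsf RZ$ consider, fibrewise, $$\widetilde{\mathsf T}Z=\{X\},\quad \widetilde{\mathsf L}Z=\{X+\mathbf D_\psi\},\quad \breve{\mathsf L}Z=\{X+\varphi X_Z\},\quad \overline{\mathsf T}Z=\{X+F_aX_Z\},\quad \overline{\mathsf L}Z=\{X+\mathbf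 D_\psi+F_aX_Z\},$$ with $X\in\widetilde{\mathsf T}_mZ$, $\varphi,\psi\in Z_m^\dagger$, $a\in Z_m$. Then $\widetilde{\mathsf T}Z,\widetilde{\mathsf L}Z,\breve{\mathsf L}Z$ are smooth vector subbundles, $\overline{\mathsf T}Z$ is a smooth affine subbundle modelled on $\widetilde{\mathsf T}Z$ and $\overline{\mathsf L}Z$ is one modelled on $\widetilde{\mathsf L}Z$; they are characterized, respectively, by $$\varphi^0=\varphi^1=0;\quad \varphi^1-\varphi^0=0;\quad \varphi^1=0;\quad \varphi^0=-1,\ \varphi^1=0;\quad \varphi^1-\varphi^0=1,$$ and $\mathrm{Sec}(\breve{\mathsf L}Z)=\mathcal X_{ah}(Z)$. Let $\mathsf PZ$ be the phase bundle (pairs $(m,\sigma)$, $\sigma$ a section of $Z$, modulo $d(\sigma'-\sigma)(m)=0$; an affine bundle modelled on $T^*M$; the class of $(m,\sigma)$ is $\mathbf d\sigma(m)$) and let $\mathsf CZ$ be the contact bundle (pairs modulo $\sigma'(m)=\sigma(m)$ and $d(\sigma'-\sigma)(m)=0$; modelled on $T^*M\oplus\mathbb R$; the class is $\mathsf c\sigma(m)$).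 For $A=M\times\mathbb R$ (when $A$ is omitted) or $A=Z$ let $\mathrm{ADer}(Z;A)$ and $\mathrm{ADO}^1(Z;A)$ be the spaces of smooth sections of $\mathrm{Aff}_M(\mathsf PZ;A)$ and $\mathrm{Aff}_M(\mathsf CZ;A)$, acting on sections $\sigma$ of $Z$ by $D(\sigma)=D(\mathbf d\sigma)$ and $D(\sigma)=D(\mathsf c\sigma)$, respectively. Then there are identifications, induced by fibrewise linear (in (a), (c)) or affine (in (b), (d)) isomorphisms of bundles, (a) $\mathrm{ADer}(Z)=\mathrm{Sec}(\widetilde{\mathsf T}Z)=\widetilde{\mathcal X}(Z)$; (b) $\mathrm{ADer}(Z;Z)=\mathrm{Sec}(\overline{\mathsf T}Z)$; (c) $\mathrm{ADO}^1(Z)=\mathrm{Sec}(\widetilde{\mathsf L}Z)$; (d) $\mathrm{ADO}^1(Z;Z)=\mathrm{Sec}(\overline{\mathsf L}Z)$, such that, regarding $D$ as an element of $\mathrm{Sec}(\mathsf RZ)=\mathcal D^1_{ah}(Z)$, the action on every section $\sigma$ of $Z$ is given by $F_{D(\sigma)}=D(F_\sigma)$. -/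

import Mathlib

open scoped Manifold ContDiff

noncomputable section

/-- The torsor structure on a set `P` with an affine difference map `δ` into a vector group `V`
(Chasles' relation holds, and `δ · a` is bijective for each `a`). -/
@[reducible] def torsorOfDiff {V P : Type*} [AddCommGroup V] [Nonempty P] (δ : P → P → V)
    (chasles : ∀ a b c, δ a b + δ b c = δ a c)
    (bij : ∀ a, Function.Bijective fun x => δ x a) : AddTorsor V P where
  vadd v a := ((bij a).2 v).choose
  vsub := δ
  zero_vadd a := by
    refine (bij a).1 (((bij a).2 0).choose_spec.trans ?_)
    have := chasles a a a
    exact (add_eq_left.1 this).symm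
  add_vadd v w a := by
    have h1 := ((bij a).2 (v + w)).choose_spec
    have h2 := ((bij a).2 w).choose_spec
    have h3 := ((bij ((bij a).2 w).choose).2 v).choose_spec
    refine (bij a).1 (h1.trans ?_)
    change v + w = δ _ a
    rw [← chasles _ ((bij a).2 w).choose a]
    exact congrArg₂ (· + ·) h3.symm h2.symm
  nonempty := inferInstance
  vsub_vadd' a b := (bij b).1 ((bij b).2 (δ a b)).choose_spec
  vadd_vsub' v a := ((bij a).2 v).choose_spec

/-- Given a difference map `δ` on `S` satisfying Chasles' relation, identify `a` and `b` when
`δ a b = 0`. -/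
@[reducible] def diffSetoid {V S : Type*} [AddCommGroup V] (δ : S → S → V)
    (chasles : ∀ a b c, δ a b + δ b c = δ a c) : Setoid S where
  r a b := δ a b = 0
  iseqv := by
    have h0 : ∀ a, δ a a = 0 := fun a => add_eq_left.1 (chasles a a a)
    refine ⟨h0, fun {a b} h => ?_, fun {a b c} h h' => ?_⟩
    · have := chasles a b a
      rwa [h, h0, zero_add] at this
    · rw [← chasles a b c, h, h', add_zero]

/-- The difference map induced on the quotient. -/
def quotDiff {V S : Type*} [AddCommGroup V] (δ : S → S → V)
    (chasles : ∀ a b c, δ a b + δ b c = δ a c) :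
    Quotient (diffSetoid δ chasles) → Quotient (diffSetoid δ chasles) → V :=
  Quotient.lift₂ δ fun a b a' b' ha hb => by
    have ha : δ a a' = 0 := ha
    have hb : δ b' b = 0 := (diffSetoid δ chasles).iseqv.symm hb
    rw [← chasles a a' b, ha, zero_add, ← chasles a' b' b, hb, add_zero]

/-- The quotient is an affine space if every vector is a difference. -/
@[reducible] def quotTorsor {V S : Type*} [AddCommGroup V] [Nonempty S] (δ : S → S → V)
    (chasles : ∀ a b c, δ a b + δ b c = δ a c) (surj : ∀ a v, ∃ b, δ b a = v) :
    AddTorsor V (Quotient (diffSetoid δ chasles)) :=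
  haveI : Nonempty (Quotient (diffSetoid δ chasles)) := ‹Nonempty S›.map (Quotient.mk _)
  torsorOfDiff (quotDiff δ chasles)
    (fun a b c => Quotient.inductionOn₃ a b c fun a b c => chasles a b c)
    (fun a => by
      induction a using Quotient.inductionOn with | _ a
      constructor
      · intro x y h
        induction x using Quotient.inductionOn with | _ x
        induction y using Quotient.inductionOn with | _ y
        have h : δ x a = δ y a := h
        have h1 := chasles x y a
        rw [h] at h1
        exact Quotient.sound (add_eq_right.1 h1)
      · intro v
        obtain ⟨b, hb⟩ := surj a v
        exact ⟨Quotient.mk _ b, hb⟩)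

section AV

variable {E : Type*} [NormedAddCommGroup E] [NormedSpace ℝ E]
  {H : Type*} [TopologicalSpace H] {I : ModelWithCorners ℝ E H}
  {F : Type*} [NormedAddCommGroup F] [NormedSpace ℝ F]
  {G : Type*} [TopologicalSpace G] {J : ModelWithCorners ℝ F G}
  {M : Type*} [TopologicalSpace M] [ChartedSpace H M]
  {Z : Type*} [TopologicalSpace Z] [ChartedSpace G Z] [AddAction ℝ Z]

variable (I J M Z) in
/-- A bundle of affine values (AV-bundle) `ζ : Z → M`: a one-dimensional smooth affine bundle whose
model bundle carries a distinguished nowhere vanishing section, and is thereby identified with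
`M × ℝ`.  Equivalently: a principal bundle with group `(ℝ, +)`; `r +ᵥ z` is the point
`z + r` of the fibre of `z`. -/
structure AVBundle where
  /-- the projection -/
  proj : Z → M
  contMDiff_proj : ContMDiff J I ∞ proj
  contMDiff_vadd : ContMDiff (𝓘(ℝ, ℝ).prod J) J ∞ fun p : ℝ × Z => p.1 +ᵥ p.2
  proj_eq_iff : ∀ z z' : Z, proj z = proj z' ↔ ∃ r : ℝ, r +ᵥ z' = z
  free : ∀ (r : ℝ) (z : Z), r +ᵥ z = z → r = 0
  /-- local triviality: near each point there is a section `σ` for which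
  `(x, r) ↦ r +ᵥ σ x` is a diffeomorphism `U × ℝ → ζ⁻¹(U)`, with inverse `z ↦ (ζ z, s z)`. -/
  locallyTrivial : ∀ m : M, ∃ (U : Set M) (σ : M → Z) (s : Z → ℝ), IsOpen U ∧ m ∈ U ∧
    ContMDiffOn I J ∞ σ U ∧ (∀ x ∈ U, proj (σ x) = x) ∧
    ContMDiffOn J 𝓘(ℝ, ℝ) ∞ s (proj ⁻¹' U) ∧ ∀ z, proj z ∈ U → s z +ᵥ σ (proj z) = z

namespace AVBundle

variable (ζ : AVBundle I J M Z)

/-! ### Fibres and sections -/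

/-- The fibre `Z_m`. -/
structure Fiber (m : M) where
  /-- the underlying point of `Z` -/
  val : Z
  proj_val : ζ.proj val = m

theorem fiber_ext {ζ : AVBundle I J M Z} {m : M} {a b : ζ.Fiber m} (h : a.val = b.val) :
    a = b := by
  cases a; cases b; simpa using h

/-- A point of `Z` as a point of its fibre. -/
def pt (z : Z) : ζ.Fiber (ζ.proj z) := ⟨z, rfl⟩

instance (m : M) : Nonempty (ζ.Fiber m) := by
  obtain ⟨U, σ, s, -, hm, -, h, -⟩ := ζ.locallyTrivial m
  exact ⟨⟨σ m, h m hm⟩⟩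

/-- The difference `a - b` of two points of the same fibre. -/
def fiberDiff {m : M} (a b : ζ.Fiber m) : ℝ :=
  ((ζ.proj_eq_iff a.1 b.1).1 (a.2.trans b.2.symm)).choose

theorem fiberDiff_vadd {m : M} (a b : ζ.Fiber m) : ζ.fiberDiff a b +ᵥ b.1 = a.1 :=
  ((ζ.proj_eq_iff a.1 b.1).1 (a.2.trans b.2.symm)).choose_spec

theorem vadd_inj (ζ : AVBundle I J M Z) {r r' : ℝ} {z : Z} (h : r +ᵥ z = r' +ᵥ z) : r = r' := by
  have : (-r' + r) +ᵥ z = z := by rw [add_vadd, h, neg_vadd_vadd]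
  have := ζ.free _ _ this
  linarith

theorem proj_vadd (r : ℝ) (z : Z) : ζ.proj (r +ᵥ z) = ζ.proj z :=
  (ζ.proj_eq_iff _ _).2 ⟨r, rfl⟩

theorem fiberDiff_unique {m : M} {a b : ζ.Fiber m} {r : ℝ} (h : r +ᵥ b.1 = a.1) :
    ζ.fiberDiff a b = r :=
  ζ.vadd_inj ((ζ.fiberDiff_vadd a b).trans h.symm)

/-- The fibre is a one-dimensional affine space modelled on `ℝ`. -/
instance fiberTorsor (m : M) : AddTorsor ℝ (ζ.Fiber m) :=
  torsorOfDiff ζ.fiberDiff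
    (fun a b c => (ζ.fiberDiff_unique (by
      rw [add_vadd, ζ.fiberDiff_vadd, ζ.fiberDiff_vadd])).symm)
    (fun a => ⟨fun x y h => fiber_ext (by
        have h : ζ.fiberDiff x a = ζ.fiberDiff y a := h
        rw [← ζ.fiberDiff_vadd x a, h, ζ.fiberDiff_vadd y a]),
      fun r => ⟨⟨r +ᵥ a.1, (ζ.proj_vadd r a.1).trans a.2⟩, ζ.fiberDiff_unique rfl⟩⟩)

/-- A family `t m ∈ Z_m` is smooth. -/
def IsSmoothSection (t : ∀ m, ζ.Fiber m) : Prop :=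
  ContMDiff I J ∞ fun m => (t m).1

/-- `Sec(Z)`: the smooth sections of `Z`. -/
structure Sec where
  /-- the values of the section -/
  val : ∀ m, ζ.Fiber m
  smooth : ζ.IsSmoothSection val

/-- The difference `σ - σ'` of two sections, a function on `M`. -/
def secDiff (σ σ' : ζ.Sec) (m : M) : ℝ := σ.1 m -ᵥ σ'.1 m

theorem contMDiff_secDiff (σ σ' : ζ.Sec) : ContMDiff I 𝓘(ℝ, ℝ) ∞ (ζ.secDiff σ σ') := by
  intro m
  obtain ⟨U, τ, s, hU, hm, -, -, hs, hsτ⟩ := ζ.locallyTrivial m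
  have key : ∀ x ∈ U, ζ.secDiff σ σ' x = s (σ.1 x).1 - s (σ'.1 x).1 := by
    intro x hx
    refine ζ.fiberDiff_unique ?_
    have h1 := hsτ (σ.1 x).1 (by rw [(σ.1 x).2]; exact hx)
    have h2 := hsτ (σ'.1 x).1 (by rw [(σ'.1 x).2]; exact hx)
    rw [(σ.1 x).2] at h1
    rw [(σ'.1 x).2] at h2
    calc (s (σ.1 x).1 - s (σ'.1 x).1) +ᵥ (σ'.1 x).1
        = (s (σ.1 x).1 - s (σ'.1 x).1) +ᵥ (s (σ'.1 x).1 +ᵥ τ x) := congrArg _ h2.symm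
      _ = (σ.1 x).1 := by rw [← add_vadd, sub_add_cancel, h1]
  have sm : ∀ ρ : ζ.Sec, ContMDiffAt I 𝓘(ℝ, ℝ) ∞ (fun x => s (ρ.1 x).1) m := by
    intro ρ
    have hρ : ContMDiffAt I J ∞ (fun x => (ρ.1 x).1) m := ρ.2 m
    have hz : ζ.proj (ρ.1 m).1 ∈ U := by rw [(ρ.1 m).2]; exact hm
    have hs' : ContMDiffAt J 𝓘(ℝ, ℝ) ∞ s (ρ.1 m).1 :=
      hs.contMDiffAt ((hU.preimage ζ.contMDiff_proj.continuous).mem_nhds hz)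
    exact hs'.comp m hρ
  refine ((sm σ).sub (sm σ')).congr_of_eventuallyEq ?_
  filter_upwards [hU.mem_nhds hm] with x hx using key x hx

/-- The section `σ + f`. -/
def secAdd (σ : ζ.Sec) (f : M → ℝ) (hf : ContMDiff I 𝓘(ℝ, ℝ) ∞ f) : ζ.Sec :=
  ⟨fun m => f m +ᵥ σ.1 m, by
    have h : ∀ (m : M) (r : ℝ) (a : ζ.Fiber m), (r +ᵥ a : ζ.Fiber m).1 = r +ᵥ a.1 := by
      intro m r a
      have h1 := ζ.fiberDiff_vadd (r +ᵥ a) a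
      have h2 : ζ.fiberDiff (r +ᵥ a) a = r := vadd_vsub r a
      rw [← h1, h2]
    have : (fun m => (f m +ᵥ σ.1 m : ζ.Fiber m).1) = fun m => f m +ᵥ (σ.1 m).1 := by
      funext m; exact h m _ _
    unfold IsSmoothSection
    rw [this]
    exact ζ.contMDiff_vadd.comp (hf.prodMk σ.2)⟩

theorem secDiff_secAdd (σ : ζ.Sec) (f : M → ℝ) (hf : ContMDiff I 𝓘(ℝ, ℝ) ∞ f) :
    ζ.secDiff (ζ.secAdd σ f hf) σ = f := by
  funext m
  exact vadd_vsub (f m) (σ.1 m)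

theorem secDiff_add (σ₁ σ₂ σ₃ : ζ.Sec) :
    ζ.secDiff σ₁ σ₂ + ζ.secDiff σ₂ σ₃ = ζ.secDiff σ₁ σ₃ := by
  funext m
  exact vsub_add_vsub_cancel _ _ _

/-- Smooth sections exist: average the fibre coordinates with a partition of unity. -/
instance [FiniteDimensional ℝ E] [IsManifold I ∞ M] [T2Space M] [SigmaCompactSpace M] :
    Nonempty ζ.Sec := by
  choose U τ s hU hmU hτ hτp hs hsτ using ζ.locallyTrivial
  obtain ⟨ρ, hρ⟩ := SmoothPartitionOfUnity.exists_isSubordinate I isClosed_univ U hU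
    (fun x _ => Set.mem_iUnion.2 ⟨x, hmU x⟩)
  set g : Z → ℝ := fun z => ∑ᶠ i, ρ i (ζ.proj z) * s i z with hg
  have hfin : ∀ x, {i | ρ i x ≠ 0}.Finite := fun x => ρ.locallyFinite.point_finite x
  have hgs : ContMDiff J 𝓘(ℝ, ℝ) ∞ g := by
    refine contMDiff_finsum (fun i => ?_) ?_
    · refine contMDiff_of_tsupport fun z hz => ?_
      have hcl : tsupport (fun z => ρ i (ζ.proj z) * s i z) ⊆ ζ.proj ⁻¹' (tsupport (ρ i)) := by
        refine closure_minimal (fun z hz => ?_)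
          ((isClosed_tsupport _).preimage ζ.contMDiff_proj.continuous)
        exact subset_tsupport _ (left_ne_zero_of_mul hz)
      have hzU : ζ.proj z ∈ U i := hρ i (hcl hz)
      have h1 : ContMDiffAt J 𝓘(ℝ, ℝ) ∞ (s i) z :=
        (hs i).contMDiffAt (((hU i).preimage ζ.contMDiff_proj.continuous).mem_nhds hzU)
      have h2 : ContMDiffAt J 𝓘(ℝ, ℝ) ∞ (fun z => ρ i (ζ.proj z)) z :=
        ((ρ i).contMDiff.comp ζ.contMDiff_proj) z
      exact h2.mul h1
    · have h := ρ.locallyFinite.preimage_continuous ζ.contMDiff_proj.continuous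
      refine h.subset fun i z hz => ?_
      exact left_ne_zero_of_mul hz
  have hsv : ∀ i (r : ℝ) (z : Z), ζ.proj z ∈ U i → s i (r +ᵥ z) = r + s i z := by
    intro i r z hz
    have h1 := hsτ i (r +ᵥ z) (by rw [ζ.proj_vadd]; exact hz)
    rw [ζ.proj_vadd] at h1
    refine ζ.vadd_inj (h1.trans ?_)
    rw [add_vadd, hsτ i z hz]
  have hgv : ∀ (r : ℝ) (z : Z), g (r +ᵥ z) = r + g z := by
    intro r z
    have h1 : ∀ i, ρ i (ζ.proj (r +ᵥ z)) * s i (r +ᵥ z)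
        = ρ i (ζ.proj z) * r + ρ i (ζ.proj z) * s i z := by
      intro i
      rw [ζ.proj_vadd]
      by_cases h : ρ i (ζ.proj z) = 0
      · simp [h]
      · rw [hsv i r z (hρ i (subset_tsupport _ h)), mul_add]
    simp only [hg, h1]
    rw [finsum_add_distrib, ← finsum_mul', ρ.sum_eq_one (Set.mem_univ _), one_mul]
    · exact (hfin (ζ.proj z)).subset fun i hi => hi
    · exact (hfin (ζ.proj z)).subset fun i hi => left_ne_zero_of_mul hi
    · exact (hfin (ζ.proj z)).subset fun i hi => left_ne_zero_of_mul hi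
  have hinv : ∀ z z', ζ.proj z = ζ.proj z' → (-g z) +ᵥ z = (-g z') +ᵥ z' := by
    intro z z' h
    obtain ⟨r, rfl⟩ := (ζ.proj_eq_iff z z').1 h
    rw [hgv, ← add_vadd]
    congr 1
    ring
  refine ⟨⟨fun m => ⟨(-g (τ m m)) +ᵥ τ m m, by
    rw [ζ.proj_vadd]; exact hτp m m (hmU m)⟩, fun m => ?_⟩⟩
  have h1 : ContMDiffAt I J ∞ (τ m) m := (hτ m).contMDiffAt ((hU m).mem_nhds (hmU m))
  have h2 : ContMDiffAt I J ∞ (fun x => (-g (τ m x)) +ᵥ τ m x) m :=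
    (ζ.contMDiff_vadd _).comp m (((hgs.neg _).comp m h1).prodMk h1)
  refine h2.congr_of_eventuallyEq ?_
  filter_upwards [(hU m).mem_nhds (hmU m)] with x hx
  exact hinv _ _ ((hτp x x (hmU x)).trans (hτp m x hx).symm)

/-- For an affine function on fibres: `F_a(a') = a - a'`, an element of `Z†_m`. -/
def fiberF {m : M} (a : ζ.Fiber m) : ζ.Fiber m →ᵃ[ℝ] ℝ where
  toFun a' := a -ᵥ a'
  linear := -LinearMap.id
  map_vadd' a' r := by
    simp [vsub_vadd_eq_vsub_sub, sub_eq_neg_add]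

/-- The function `F_t` on `Z` of a family `t m ∈ Z_m`: `F_t(z) = t(ζ z) - z`. -/
def secF (t : ∀ m, ζ.Fiber m) (z : Z) : ℝ := t (ζ.proj z) -ᵥ ζ.pt z


/-! ### The phase bundle and the contact bundle -/

/-- Every 1-jet at `m` is the jet of a smooth function. -/
theorem exists_smooth_jet [FiniteDimensional ℝ E] [IsManifold I ∞ M] [T2Space M] (m : M)
    (p : TangentSpace I m →L[ℝ] ℝ) (r : ℝ) :
    ∃ f : M → ℝ, ContMDiff I 𝓘(ℝ, ℝ) ∞ f ∧ mvfderiv I f m = p ∧ f m = r := by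
  let p' : E →L[ℝ] ℝ := p
  obtain ⟨b⟩ : Nonempty (SmoothBumpFunction I m) := inferInstance
  let g : M → ℝ := fun x => p' (extChartAt I m x) - p' (extChartAt I m m) + r
  have hg : ContMDiffOn I 𝓘(ℝ, ℝ) ∞ g (chartAt H m).source :=
    ((p'.contMDiff.comp_contMDiffOn contMDiffOn_extChartAt).sub contMDiffOn_const).add
      contMDiffOn_const
  have heq : (fun x => b x • g x) =ᶠ[nhds m] g := by
    filter_upwards [b.eventuallyEq_one] with x hx
    simp [hx]
  refine ⟨fun x => b x • g x, b.contMDiff_smul hg, ?_, ?_⟩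
  · have h1 : HasMFDerivAt I 𝓘(ℝ, E) (extChartAt I m) m (ContinuousLinearMap.id ℝ _) := by
      rw [← mfderiv_extChartAt_self]
      exact (mdifferentiableAt_extChartAt (mem_chart_source H m)).hasMFDerivAt
    have h2 : HasMFDerivAt I 𝓘(ℝ, ℝ) (fun x => p' (extChartAt I m x)) m p :=
      (p'.hasMFDerivAt (x := extChartAt I m m)).comp m h1
    have h3 : HasMFDerivAt I 𝓘(ℝ, ℝ) g m p := by
      have := (h2.sub (hasMFDerivAt_const (p' (extChartAt I m m)) m)).add
        (hasMFDerivAt_const r m)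
      have e : (p' - 0 + 0 : E →L[ℝ] ℝ) = p' := by rw [sub_zero, add_zero]
      exact Eq.mp (congrArg (HasMFDerivAt I 𝓘(ℝ, ℝ) g m) e) this
    have h4 : HasMFDerivAt I 𝓘(ℝ, ℝ) (fun x => b x • g x) m p :=
      h3.congr_of_eventuallyEq heq
    ext v
    simp only [mvfderiv]
    rw [h4.mfderiv]
    rfl
  · have := heq.self_of_nhds
    simp only [this, g]
    ring

/-- `d(σ - σ')(m) ∈ T*_m M`. -/
def dDiff (m : M) (σ σ' : ζ.Sec) : TangentSpace I m →L[ℝ] ℝ := mvfderiv I (ζ.secDiff σ σ') m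

theorem dDiff_add (m : M) (σ₁ σ₂ σ₃ : ζ.Sec) :
    ζ.dDiff m σ₁ σ₂ + ζ.dDiff m σ₂ σ₃ = ζ.dDiff m σ₁ σ₃ := by
  unfold dDiff
  rw [← ζ.secDiff_add σ₁ σ₂ σ₃]
  exact (mvfderiv_add ((ζ.contMDiff_secDiff _ _).mdifferentiable (by simp) m)
    ((ζ.contMDiff_secDiff _ _).mdifferentiable (by simp) m)).symm

/-- The pair `(d(σ - σ')(m), σ(m) - σ'(m)) ∈ T*_m M ⊕ ℝ`. -/
def cDiff (m : M) (σ σ' : ζ.Sec) : (TangentSpace I m →L[ℝ] ℝ) × ℝ :=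
  (ζ.dDiff m σ σ', ζ.secDiff σ σ' m)

theorem cDiff_add (m : M) (σ₁ σ₂ σ₃ : ζ.Sec) :
    ζ.cDiff m σ₁ σ₂ + ζ.cDiff m σ₂ σ₃ = ζ.cDiff m σ₁ σ₃ :=
  Prod.ext (ζ.dDiff_add m σ₁ σ₂ σ₃) (congrFun (ζ.secDiff_add σ₁ σ₂ σ₃) m)

/-- The fibre `(PZ)_m` of the phase bundle: sections modulo `d(σ' - σ)(m) = 0`. -/
def Phase (m : M) : Type _ := Quotient (diffSetoid (ζ.dDiff m) (ζ.dDiff_add m))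

/-- The fibre `(CZ)_m` of the contact bundle: sections modulo `σ'(m) = σ(m)` and
`d(σ' - σ)(m) = 0`. -/
def Contact (m : M) : Type _ := Quotient (diffSetoid (ζ.cDiff m) (ζ.cDiff_add m))

/-- The affine differential `dσ(m) ∈ (PZ)_m`. -/
def aff_d (σ : ζ.Sec) (m : M) : ζ.Phase m := Quotient.mk _ σ

/-- The contact element `cσ(m) ∈ (CZ)_m`. -/
def aff_c (σ : ζ.Sec) (m : M) : ζ.Contact m := Quotient.mk _ σ

section torsors
variable [FiniteDimensional ℝ E] [IsManifold I ∞ M] [T2Space M] [SigmaCompactSpace M]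

/-- `(PZ)_m` is an affine space modelled on `T*_m M`. -/
instance phaseTorsor (m : M) : AddTorsor (TangentSpace I m →L[ℝ] ℝ) (ζ.Phase m) :=
  quotTorsor (ζ.dDiff m) (ζ.dDiff_add m) fun σ p => by
    obtain ⟨f, hf, hp, -⟩ := exists_smooth_jet m p 0
    refine ⟨ζ.secAdd σ f hf, ?_⟩
    rw [dDiff, secDiff_secAdd, hp]

/-- `(CZ)_m` is an affine space modelled on `T*_m M ⊕ ℝ`. -/
instance contactTorsor (m : M) : AddTorsor ((TangentSpace I m →L[ℝ] ℝ) × ℝ) (ζ.Contact m) :=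
  quotTorsor (ζ.cDiff m) (ζ.cDiff_add m) fun σ p => by
    obtain ⟨f, hf, hp, hr⟩ := exists_smooth_jet m p.1 p.2
    refine ⟨ζ.secAdd σ f hf, ?_⟩
    rw [cDiff, dDiff, secDiff_secAdd, hp, hr]

theorem aff_d_vsub (σ σ' : ζ.Sec) (m : M) :
    ζ.aff_d σ m -ᵥ ζ.aff_d σ' m = mvfderiv I (ζ.secDiff σ σ') m := rfl

theorem aff_c_vsub (σ σ' : ζ.Sec) (m : M) :
    ζ.aff_c σ m -ᵥ ζ.aff_c σ' m = (mvfderiv I (ζ.secDiff σ σ') m, ζ.secDiff σ σ' m) := rfl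


/-- A 1-form on `M` is smooth. -/
def IsSmoothForm (η : ∀ m : M, TangentSpace I m →L[ℝ] ℝ) : Prop :=
  ContMDiff I (I.prod 𝓘(ℝ, E →L[ℝ] ℝ)) ∞ fun m =>
    (⟨m, η m⟩ : Bundle.TotalSpace (E →L[ℝ] ℝ)
      fun m : M => TangentSpace I m →L[ℝ] Bundle.Trivial M ℝ m)

/-- `Sec(PZ)`: in the trivializations `α ↦ α - dσ` of `PZ`, the section is a smooth 1-form. -/
def IsSmoothPhase (α : ∀ m, ζ.Phase m) : Prop :=
  ∀ σ : ζ.Sec, IsSmoothForm fun m => α m -ᵥ ζ.aff_d σ m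

/-- `Sec(CZ)`: in the trivializations `κ ↦ κ - cσ` of `CZ`, the section is a pair of a smooth
1-form and a smooth function. -/
def IsSmoothContact (κ : ∀ m, ζ.Contact m) : Prop :=
  ∀ σ : ζ.Sec, (IsSmoothForm fun m => (κ m -ᵥ ζ.aff_c σ m).1) ∧
    ContMDiff I 𝓘(ℝ, ℝ) ∞ fun m => (κ m -ᵥ ζ.aff_c σ m).2

/-! ### Affine derivations and affine first-order differential operators

A section `D` of a bundle `Aff_M(A; B)` is a family of affine maps `D m : A_m → B_m`; it is
smooth if and only if it carries smooth sections of `A` to smooth sections of `B`. -/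

/-- `ADer(Z) = Sec(Aff_M(PZ; ℝ))`. -/
def ADerR : Set (∀ m, ζ.Phase m →ᵃ[ℝ] ℝ) :=
  {D | ∀ α, ζ.IsSmoothPhase α → ContMDiff I 𝓘(ℝ, ℝ) ∞ fun m => D m (α m)}

/-- `ADer(Z; Z) = Sec(Aff_M(PZ; Z))`. -/
def ADerZ : Set (∀ m, ζ.Phase m →ᵃ[ℝ] ζ.Fiber m) :=
  {D | ∀ α, ζ.IsSmoothPhase α → ζ.IsSmoothSection fun m => D m (α m)}

/-- `ADO¹(Z) = Sec(Aff_M(CZ; ℝ))`. -/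
def ADOR : Set (∀ m, ζ.Contact m →ᵃ[ℝ] ℝ) :=
  {D | ∀ κ, ζ.IsSmoothContact κ → ContMDiff I 𝓘(ℝ, ℝ) ∞ fun m => D m (κ m)}

/-- `ADO¹(Z; Z) = Sec(Aff_M(CZ; Z))`. -/
def ADOZ : Set (∀ m, ζ.Contact m →ᵃ[ℝ] ζ.Fiber m) :=
  {D | ∀ κ, ζ.IsSmoothContact κ → ζ.IsSmoothSection fun m => D m (κ m)}

end torsors

/-! ### First-order operators on the total space -/

variable (J Z) in
/-- A (not necessarily smooth) section of `TZ ⊕ ℝ`, read as the first-order operator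
`f ↦ X(f) + h f`. -/
abbrev Op : Type _ := (∀ z : Z, TangentSpace J z) × (Z → ℝ)

/-- The action of `X + h` on functions. -/
def Op.act (D : Op J Z) (f : Z → ℝ) (z : Z) : ℝ := mvfderiv J f z (D.1 z) + D.2 z * f z

/-- Smoothness over a set: `X` and `h` are smooth there. -/
def Op.SmoothOn [IsManifold J ∞ Z] (D : Op J Z) (s : Set Z) : Prop :=
  ContMDiffOn J J.tangent ∞ (fun z => (⟨z, D.1 z⟩ : TangentBundle J Z)) s ∧
    ContMDiffOn J 𝓘(ℝ, ℝ) ∞ D.2 s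

/-- The commutator of two operators. -/
def Op.comm (D D' : Op J Z) (f : Z → ℝ) (z : Z) : ℝ :=
  D.act (D'.act f) z - D'.act (D.act f) z

variable (J) in
/-- The fundamental vector field `X_Z` of the `(ℝ, +)`-action, with the sign convention
`X_Z = -∂_s`. -/
def fundVF (z : Z) : TangentSpace J z :=
  -(show F from mfderiv 𝓘(ℝ, ℝ) J (fun r : ℝ => r +ᵥ z) 0 (1 : ℝ))

variable (J Z) in
/-- `X_Z` as an operator. -/
def opX : Op J Z := (fundVF J, 0)

variable (J Z) in
/-- `Polⁿ(Z)`: smooth functions with `X_Z^{n+1}(f) = 0`. -/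
def Pol (n : ℕ) : Set (Z → ℝ) :=
  {f | ContMDiff J 𝓘(ℝ, ℝ) ∞ f ∧ (opX J Z).act^[n + 1] f = 0}

variable (J Z) in
/-- `𝒟¹_ah(Z)`: smooth first-order operators preserving the filtration by the `Polⁿ(Z)`. -/
def D1ah [IsManifold J ∞ Z] : Set (Op J Z) :=
  {D | D.SmoothOn Set.univ ∧ ∀ n, ∀ f ∈ Pol J Z n, D.act f ∈ Pol J Z n}

variable (J Z) in
/-- `𝒳_ah(Z)`: affine-homogeneous vector fields. -/
def Xah [IsManifold J ∞ Z] : Set (Op J Z) := {D ∈ D1ah J Z | D.2 = 0}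

variable (J Z) in
/-- `X̃(Z)`: invariant vector fields, `[X_Z, X] = 0`. -/
def Xinv [IsManifold J ∞ Z] : Set (Op J Z) :=
  {D | D.SmoothOn Set.univ ∧ D.2 = 0 ∧
    ∀ f, ContMDiff J 𝓘(ℝ, ℝ) ∞ f → (opX J Z).comm D f = 0}

/-! ### The bundle `RZ` -/

/-- A first-order operator along the fibre `Z_m`: a field of tangent vectors of `Z` along `Z_m`,
together with a constant. -/
abbrev FiberOp (m : M) : Type _ := (∀ a : ζ.Fiber m, TangentSpace J a.val) × ℝ

/-- `(T̃Z)_m = (TZ|_{Z_m})/ℝ`; an orbit of the tangent lift of the action is the same thing as an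
invariant field of tangent vectors along `Z_m`. -/
def atiyah (m : M) : Submodule ℝ (∀ a : ζ.Fiber m, TangentSpace J a.val) where
  carrier := {v | ∀ a b : ζ.Fiber m,
    (show F from v b) = mfderiv J J (fun z : Z => (b -ᵥ a : ℝ) +ᵥ z) a.val (v a)}
  add_mem' {v w} hv hw a b := by
    have h := map_add (mfderiv J J (fun z : Z => (b -ᵥ a : ℝ) +ᵥ z) a.val) (v a) (w a)
    exact (congrArg₂ (fun x y : F => x + y) (hv a b) (hw a b)).trans h.symm
  zero_mem' a b := (map_zero (mfderiv J J (fun z : Z => (b -ᵥ a : ℝ) +ᵥ z) a.val)).symm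
  smul_mem' c v hv a b := by
    have h := map_smul (mfderiv J J (fun z : Z => (b -ᵥ a : ℝ) +ᵥ z) a.val) c (v a)
    exact (congrArg (fun x : F => c • x) (hv a b)).trans h.symm

/-- The realization `X ⊕ φ ⊕ ψ ↦ X + φ X_Z + 𝐃_ψ`, where `𝐃_ψ = ψ X_Z - X_Z(ψ)`, on the fibre over
`m`; here `-X_Z(ψ)` is the slope of `ψ`.  Its kernel is spanned by `(X_Z, -1, 0)` and
`(X_Z, 0, -1)`, so that its range is a copy of the special direct sum
`(T̃Z)_m ⊕ Z†_m ⊕ Z†_m` of special vector spaces. -/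
def realize (m : M) :
    (ζ.atiyah m × (ζ.Fiber m →ᵃ[ℝ] ℝ) × (ζ.Fiber m →ᵃ[ℝ] ℝ)) →ₗ[ℝ] ζ.FiberOp m where
  toFun p := (fun a => p.1.1 a + (p.2.1 a + p.2.2 a) • fundVF J a.val, p.2.2.linear 1)
  map_add' p q := by
    refine Prod.ext (funext fun a => ?_) rfl
    change (p.1.1 a + q.1.1 a) + ((p.2.1 a + q.2.1 a) + (p.2.2 a + q.2.2 a)) • fundVF J a.val
      = (p.1.1 a + (p.2.1 a + p.2.2 a) • fundVF J a.val)
        + (q.1.1 a + (q.2.1 a + q.2.2 a) • fundVF J a.val)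
    module
  map_smul' c p := by
    refine Prod.ext (funext fun a => ?_) rfl
    change c • p.1.1 a + (c • p.2.1 a + c • p.2.2 a) • fundVF J a.val
      = c • (p.1.1 a + (p.2.1 a + p.2.2 a) • fundVF J a.val)
    simp only [smul_eq_mul]
    module

/-- The fibre `(RZ)_m`, `RZ = T̃Z ⊕ Z† ⊕ Z†` (special direct sums), realized by operators along
`Z_m`. -/
def RZ (m : M) : Submodule ℝ (ζ.FiberOp m) := LinearMap.range (ζ.realize m)

/-- The class of `X ⊕ φ ⊕ ψ` in `(RZ)_m`. -/
def mkR (m : M) :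
    (ζ.atiyah m × (ζ.Fiber m →ᵃ[ℝ] ℝ) × (ζ.Fiber m →ᵃ[ℝ] ℝ)) →ₗ[ℝ] ζ.RZ m :=
  (ζ.realize m).rangeRestrict

/-- The operator on `Z` given by a section of `RZ`. -/
def toOp (R : ∀ m, ζ.RZ m) : Op J Z :=
  (fun z => (R (ζ.proj z)).1.1 (ζ.pt z), fun z => (R (ζ.proj z)).1.2)

/-- Smoothness over `U ⊆ M` of a section of `RZ`: the operator is smooth over `ζ⁻¹(U)`. -/
def SmoothOnR [IsManifold J ∞ Z] (U : Set M) (R : ∀ m, ζ.RZ m) : Prop := (ζ.toOp R).SmoothOn (ζ.proj ⁻¹' U)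

/-- `Sec(S)` for a family of subsets `S m ⊆ (RZ)_m`. -/
def SecR [IsManifold J ∞ Z] (S : ∀ m, Set (ζ.RZ m)) : Set (∀ m, ζ.RZ m) :=
  {R | ζ.SmoothOnR Set.univ R ∧ ∀ m, R m ∈ S m}

/-- The 1-form `φ¹` on `RZ`: `⟨φ¹, X + γ⟩ = γ`. -/
def phi1 (m : M) : ζ.RZ m →ₗ[ℝ] ℝ := (LinearMap.snd ℝ _ _).comp (ζ.RZ m).subtype

/-- A smooth section `φ` of `RZ*`. -/
def IsSmoothDual [IsManifold J ∞ Z] (φ : ∀ m, ζ.RZ m →ₗ[ℝ] ℝ) : Prop :=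
  ∀ R, ζ.SmoothOnR Set.univ R → ContMDiff I 𝓘(ℝ, ℝ) ∞ fun m => φ m (R m)

/-- The defining property of the 1-form `φ⁰` on `RZ`: `[R, X_Z] = ⟨φ⁰, R⟩ X_Z` for all smooth
sections `R` of `RZ`, the bracket being the commutator of operators. -/
def IsPhi0 [IsManifold J ∞ Z] (φ : ∀ m, ζ.RZ m →ₗ[ℝ] ℝ) : Prop :=
  ζ.IsSmoothDual φ ∧ ∀ R, ζ.SmoothOnR Set.univ R → ∀ f, ContMDiff J 𝓘(ℝ, ℝ) ∞ f → ∀ z,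
    (ζ.toOp R).comm (opX J Z) f z = φ (ζ.proj z) (R (ζ.proj z)) * (opX J Z).act f z

/-- Smooth frame over `U` of the family of subspaces `S m ⊆ (RZ)_m`. -/
def IsFrame [IsManifold J ∞ Z] (S : ∀ m, Submodule ℝ (ζ.RZ m)) (U : Set M) {k : ℕ} (e : Fin k → ∀ m, ζ.RZ m) :
    Prop :=
  (∀ i, ζ.SmoothOnR U (e i)) ∧ ∀ m ∈ U, LinearIndependent ℝ (fun i => e i m) ∧
    Submodule.span ℝ (Set.range fun i => e i m) = S m

/-- `RZ` is a smooth vector bundle: near each point there is a frame of smooth sections, and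
a section is smooth if and only if its coefficients in the frame are. -/
def IsVectorBundleR [IsManifold J ∞ Z] : Prop :=
  ∀ m : M, ∃ U : Set M, IsOpen U ∧ m ∈ U ∧ ∃ (k : ℕ) (e : Fin k → ∀ m, ζ.RZ m),
    ζ.IsFrame (fun _ => ⊤) U e ∧ ∀ W ⊆ U, IsOpen W → ∀ (c : Fin k → M → ℝ) (R : ∀ m, ζ.RZ m),
      (∀ x ∈ W, R x = ∑ i, c i x • e i x) →
        (ζ.SmoothOnR W R ↔ ∀ i, ContMDiffOn I 𝓘(ℝ, ℝ) ∞ (c i) W)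

/-- The `S m` form a smooth vector subbundle of `RZ`. -/
def IsVectorSubbundle [IsManifold J ∞ Z] (S : ∀ m, Submodule ℝ (ζ.RZ m)) : Prop :=
  ∀ m : M, ∃ U : Set M, IsOpen U ∧ m ∈ U ∧ ∃ (k : ℕ) (e : Fin k → ∀ m, ζ.RZ m), ζ.IsFrame S U e

/-- The `A m` form a smooth affine subbundle of `RZ` modelled on the vector subbundle `S`. -/
def IsAffineSubbundle [IsManifold J ∞ Z] (A : ∀ m, Set (ζ.RZ m)) (S : ∀ m, Submodule ℝ (ζ.RZ m)) : Prop :=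
  ζ.IsVectorSubbundle S ∧ ∀ m : M, ∃ U : Set M, IsOpen U ∧ m ∈ U ∧ ∃ a : ∀ m, ζ.RZ m,
    ζ.SmoothOnR U a ∧ ∀ x ∈ U, A x = {R | R - a x ∈ S x}

/-- `T̃Z ⊆ RZ`, consisting of the `X ⊕ 0 ⊕ 0`. -/
def TTilde (m : M) : Submodule ℝ (ζ.RZ m) :=
  Submodule.map (ζ.mkR m) (Submodule.prod ⊤ (Submodule.prod ⊥ ⊥))

/-- `L̆Z = T̃Z ⊕ Z†`, with `Z†` in the first place: the `X ⊕ φ ⊕ 0`, i.e. `X + φ X_Z`. -/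
def LBreve (m : M) : Submodule ℝ (ζ.RZ m) :=
  Submodule.map (ζ.mkR m) (Submodule.prod ⊤ (Submodule.prod ⊤ ⊥))

/-- `L̃Z = T̃Z ⊕ Z†`, with `Z†` in the second place: the `X ⊕ 0 ⊕ ψ`, i.e. `X + 𝐃_ψ`. -/
def LTilde (m : M) : Submodule ℝ (ζ.RZ m) :=
  Submodule.map (ζ.mkR m) (Submodule.prod ⊤ (Submodule.prod ⊥ ⊤))

/-- `T̄Z`, the image of `T̃Z ⊠ Z` in `L̆Z`: the `X + F_a X_Z`, with `a ∈ Z_m`. -/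
def TBar (m : M) : Set (ζ.RZ m) := {R | ∃ X a, R = ζ.mkR m (X, ζ.fiberF a, 0)}

/-- `L̄Z`, the image of `L̃Z ⊠ Z` in `RZ`: the `X + 𝐃_ψ + F_a X_Z`, with `a ∈ Z_m`. -/
def LBar (m : M) : Set (ζ.RZ m) := {R | ∃ X a ψ, R = ζ.mkR m (X, ζ.fiberF a, ψ)}

end AVBundle
end AV
end

noncomputable section

namespace AVBundle

variable {E : Type*} [NormedAddCommGroup E] [NormedSpace ℝ E]
  {H : Type*} [TopologicalSpace H] {I : ModelWithCorners ℝ E H}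
  {F : Type*} [NormedAddCommGroup F] [NormedSpace ℝ F]
  {G : Type*} [TopologicalSpace G] {J : ModelWithCorners ℝ F G}
  {M : Type*} [TopologicalSpace M] [ChartedSpace H M]
  {Z : Type*} [TopologicalSpace Z] [ChartedSpace G Z] [AddAction ℝ Z]
  {ζ : AVBundle I J M Z}

section

/-! ### The trivialization of `Z` given by a global section -/

/-! A partition of unity yields a global section `σ` of `Z`, and `σ` trivializes `Z` as `M × ℝ` by
`z ↦ (ζ z, height σ z)`, with `F_σ = -height σ`. An element of `(RZ)_m` is then uniquely an operator
`v + (α + β F_σ) X_Z + γ` along `Z_m`, with `v ∈ T_m M` lifted horizontally and `α, β, γ ∈ ℝ`. These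
are the coordinates `(v, α, β, γ)` of `coord`, and the whole theorem is read off from them.

Smoothness: a section of `RZ` is smooth as an operator on `Z` exactly when `v` is a smooth vector
field and `α, β, γ` are smooth functions on `M` (`smoothOnR_iff`). In coordinates the three vector
subbundles are `E × K` with `K ⊆ ℝ³` a fixed subspace, so a local frame of `TM` and a basis of `K`
give a frame (`exists_frame`). The two affine subbundles are their translates by `F_σ X_Z`.

Operators: horizontal lifts commute with `X_Z`, by the symmetry of second derivatives
(`hasDerivAt_dfun_lift`). Hence `X_Z ∘ R = R ∘ X_Z + β X_Z` (`opX_act_toOp_act`), so that smooth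
sections preserve every `Polⁿ` and `φ⁰ = -β`, while `φ¹ = γ`. Conversely, the values of an operator
on constants, on basic functions and on `height σ` determine it. Preservation of `Pol⁰` and `Pol¹`
forces these values to be those of an operator with such coordinates (`exists_toOp_eq_of_mem_D1ah`).

Affine derivations: an affine function on `(PZ)_m` is its linear part, a vector `v` by biduality,
together with its value `α` at `dσ(m)`. On `(CZ)_m` there is in addition the coefficient `γ` of the
value coordinate, and `β = -γ`. Since `F_τ = (τ - σ) ∘ ζ - height σ`, the operator with these
coordinates sends `F_τ` to the required function (`act_secF`). Maps with values in `Z` reduce to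
functions by subtracting `σ`, which on the side of `RZ` is subtracting `F_σ X_Z`
(`exists_affine_identification`). -/

theorem fiber_vadd_val {m : M} (r : ℝ) (a : ζ.Fiber m) : (r +ᵥ a : ζ.Fiber m).val = r +ᵥ a.val := by
  have h1 := ζ.fiberDiff_vadd (r +ᵥ a) a
  have h2 : ζ.fiberDiff (r +ᵥ a) a = r := vadd_vsub r a
  rw [← h1, h2]

theorem fiber_vsub_vadd_val {m : M} (a b : ζ.Fiber m) : (a -ᵥ b : ℝ) +ᵥ b.val = a.val :=
  ζ.fiberDiff_vadd a b

theorem fiber_vsub_eq {m : M} {a b : ζ.Fiber m} {r : ℝ} (h : r +ᵥ b.val = a.val) : a -ᵥ b = r :=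
  ζ.fiberDiff_unique h

/-- The height `z - σ(ζ z)` of a point of `Z` over the section `σ`. -/
def height (σ : ζ.Sec) (z : Z) : ℝ := ζ.pt z -ᵥ σ.val (ζ.proj z)

theorem height_vadd_sec (σ : ζ.Sec) (z : Z) : height σ z +ᵥ (σ.val (ζ.proj z)).val = z :=
  fiber_vsub_vadd_val (ζ.pt z) _

theorem height_eq_of_vadd (σ : ζ.Sec) {z : Z} {r : ℝ} (h : r +ᵥ (σ.val (ζ.proj z)).val = z) :
    height σ z = r := fiber_vsub_eq h

theorem height_vadd (σ : ζ.Sec) (r : ℝ) (z : Z) : height σ (r +ᵥ z) = r + height σ z := by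
  apply height_eq_of_vadd
  rw [ζ.proj_vadd, add_vadd, height_vadd_sec]

theorem proj_vadd_sec (σ : ζ.Sec) (r : ℝ) (m : M) : ζ.proj (r +ᵥ (σ.val m).val) = m := by
  rw [ζ.proj_vadd, (σ.val m).proj_val]

theorem height_sec (σ : ζ.Sec) (r : ℝ) (m : M) : height σ (r +ᵥ (σ.val m).val) = r := by
  apply height_eq_of_vadd
  rw [proj_vadd_sec]

theorem height_val (σ : ζ.Sec) {m : M} (a : ζ.Fiber m) : height σ a.val = a -ᵥ σ.val m := by
  obtain ⟨z, rfl⟩ := a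
  rfl

theorem secF_eq_neg_height (σ : ζ.Sec) (z : Z) : ζ.secF σ.val z = -height σ z :=
  (neg_vsub_eq_vsub_rev _ _).symm

theorem secF_eq (σ τ : ζ.Sec) (z : Z) :
    ζ.secF τ.val z = ζ.secDiff τ σ (ζ.proj z) - height σ z := by
  rw [sub_eq_add_neg, ← secF_eq_neg_height]
  exact (vsub_add_vsub_cancel _ _ _).symm

/-- If `s` is the fibre coordinate of a local trivialization, then near `z` the height is `s z - s
(σ (ζ z))`. -/
theorem contMDiff_height (σ : ζ.Sec) : ContMDiff J 𝓘(ℝ, ℝ) ∞ (height σ) := by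
  intro z
  obtain ⟨U, τ, s, hU, hm, -, -, hs, hsτ⟩ := ζ.locallyTrivial (ζ.proj z)
  have hV : ζ.proj ⁻¹' U ∈ nhds z := (hU.preimage ζ.contMDiff_proj.continuous).mem_nhds hm
  have h1 : ContMDiffAt J 𝓘(ℝ, ℝ) ∞ s z := hs.contMDiffAt hV
  have h2 : ContMDiffAt J J ∞ (fun z => (σ.val (ζ.proj z)).val) z :=
    (σ.smooth.comp ζ.contMDiff_proj) z
  have h3 : ContMDiffAt J 𝓘(ℝ, ℝ) ∞ s (σ.val (ζ.proj z)).val :=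
    hs.contMDiffAt ((hU.preimage ζ.contMDiff_proj.continuous).mem_nhds (by
      change ζ.proj _ ∈ U
      rw [(σ.val _).proj_val]; exact hm))
  refine (h1.sub (h3.comp z h2)).congr_of_eventuallyEq ?_
  filter_upwards [hV] with y hy
  apply height_eq_of_vadd
  have e1 := hsτ y hy
  have e2 := hsτ (σ.val (ζ.proj y)).val (by rw [(σ.val _).proj_val]; exact hy)
  rw [(σ.val _).proj_val] at e2
  change (s y - s (σ.val (ζ.proj y)).val) +ᵥ _ = y
  calc _ = (s y - s (σ.val (ζ.proj y)).val) +ᵥ (s (σ.val (ζ.proj y)).val +ᵥ τ (ζ.proj y)) := by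
        rw [e2]
    _ = y := by rw [← add_vadd, sub_add_cancel, e1]

theorem contMDiff_vadd_const (ζ : AVBundle I J M Z) (r : ℝ) : ContMDiff J J ∞ fun z : Z => r +ᵥ z :=
  ζ.contMDiff_vadd.comp (contMDiff_const.prodMk contMDiff_id)

theorem contMDiff_vadd_sec (σ : ζ.Sec) :
    ContMDiff (I.prod 𝓘(ℝ, ℝ)) J ∞ fun p : M × ℝ => p.2 +ᵥ (σ.val p.1).val :=
  ζ.contMDiff_vadd.comp (contMDiff_snd.prodMk (σ.smooth.comp contMDiff_fst))

theorem contMDiff_vadd_sec_left (σ : ζ.Sec) (r : ℝ) :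
    ContMDiff I J ∞ fun x : M => r +ᵥ (σ.val x).val :=
  (contMDiff_vadd_sec σ).comp (contMDiff_id.prodMk contMDiff_const)

theorem contMDiff_orbit (ζ : AVBundle I J M Z) (z : Z) :
    ContMDiff 𝓘(ℝ, ℝ) J ∞ fun r : ℝ => r +ᵥ z :=
  ζ.contMDiff_vadd.comp (contMDiff_id.prodMk contMDiff_const)

/-! ### Horizontal lifts and the splitting of tangent vectors of `Z` -/

/-- The horizontal lift, along the translates of the section `σ`, of tangent vectors of `M`. -/
def lift (σ : ζ.Sec) (z : Z) : E →L[ℝ] F :=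
  mfderiv I J (fun x => height σ z +ᵥ (σ.val x).val) (ζ.proj z)

variable (J) in
/-- The differential of a function at a point, on the model space. -/
abbrev dfun (f : Z → ℝ) (z : Z) : F →L[ℝ] ℝ := mvfderiv J f z

/-- The differential of the projection, on the model spaces. -/
def dproj (ζ : AVBundle I J M Z) (z : Z) : F →L[ℝ] E := mfderiv J I ζ.proj z

variable (J) in
/-- The value `X_Z(z)`, as a vector of the model space. -/
def fundVec (z : Z) : F := fundVF J z

theorem dfun_lift (σ : ζ.Sec) {f : Z → ℝ} {z : Z} (hf : MDifferentiableAt J 𝓘(ℝ, ℝ) f z) (v : E) :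
    dfun J f z (lift σ z v) = dfun I (fun x => f (height σ z +ᵥ (σ.val x).val)) (ζ.proj z) v :=
  (mvfderiv_comp_apply_of_eq (ζ.proj z) hf
    ((contMDiff_vadd_sec_left σ (height σ z)).mdifferentiable (by simp) _)
    (height_vadd_sec σ z) v).symm

/-- This turns `X_Z` into an ordinary derivative along the orbit. The sign comes from `X_Z = -∂_s`.
-/
theorem hasDerivAt_orbit (ζ : AVBundle I J M Z) {f : Z → ℝ} {z : Z}
    (hf : MDifferentiableAt J 𝓘(ℝ, ℝ) f z) :
    HasDerivAt (fun r : ℝ => f (r +ᵥ z)) (-dfun J f z (fundVec J z)) 0 := by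
  have h1 : MDifferentiableAt 𝓘(ℝ, ℝ) J (fun r : ℝ => r +ᵥ z) 0 :=
    (contMDiff_orbit ζ z).mdifferentiable (by simp) 0
  have h2 := mvfderiv_comp_apply_of_eq (0 : ℝ) hf h1 (zero_vadd ℝ z) (1 : ℝ)
  have h3 : MDifferentiableAt 𝓘(ℝ, ℝ) 𝓘(ℝ, ℝ) (f ∘ fun r : ℝ => r +ᵥ z) 0 :=
    MDifferentiableAt.comp_of_eq (0 : ℝ) hf h1 (zero_vadd ℝ z)
  have h4 := h3.differentiableAt.hasDerivAt
  have h5 : -dfun J f z (fundVec J z) = deriv (f ∘ fun r : ℝ => r +ᵥ z) 0 := by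
    have : dfun J f z (fundVec J z) = - (dfun J f z
      (mfderiv 𝓘(ℝ, ℝ) J (fun r : ℝ => r +ᵥ z) 0 (1 : ℝ))) := map_neg (dfun J f z) _
    rw [this, neg_neg]
    refine h2.symm.trans ?_
    simp only [mvfderiv, mfderiv_eq_fderiv]
    rfl
  rw [h5]
  exact h4

theorem hasDerivAt_orbit_at (ζ : AVBundle I J M Z) {f : Z → ℝ} {z : Z} (r : ℝ)
    (hf : MDifferentiableAt J 𝓘(ℝ, ℝ) f (r +ᵥ z)) :
    HasDerivAt (fun r : ℝ => f (r +ᵥ z)) (-dfun J f (r +ᵥ z) (fundVec J (r +ᵥ z))) r := by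
  have h := hasDerivAt_orbit ζ hf
  rw [← sub_self r] at h
  refine (h.comp_sub_const r r).congr_of_eventuallyEq (.of_forall fun t => ?_)
  change f _ = f _
  rw [← add_vadd, sub_add_cancel]

theorem dfun_height_lift (σ : ζ.Sec) (z : Z) (v : E) : dfun J (height σ) z (lift σ z v) = 0 := by
  rw [dfun_lift σ ((contMDiff_height σ).mdifferentiable (by simp) z)]
  simp only [height_sec]
  rw [dfun, mvfderiv_const]
  rfl

theorem dfun_height_fundVF (σ : ζ.Sec) (z : Z) : dfun J (height σ) z (fundVec J z) = -1 := by
  have h1 := hasDerivAt_orbit ζ ((contMDiff_height σ).mdifferentiable (by simp) z)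
  simp only [height_vadd] at h1
  have h2 := h1.unique ((hasDerivAt_id (0 : ℝ)).add_const _)
  linarith

/-- Each translate of `σ` is again a section of `ζ`; differentiate that identity. -/
theorem dproj_lift (σ : ζ.Sec) (z : Z) (v : E) : dproj ζ z (lift σ z v) = v := by
  have h1 : MDifferentiableAt I J (fun x => height σ z +ᵥ (σ.val x).val) (ζ.proj z) :=
    (contMDiff_vadd_sec_left σ (height σ z)).mdifferentiable (by simp) _
  have h2 : MDifferentiableAt J I ζ.proj z := ζ.contMDiff_proj.mdifferentiable (by simp) z
  have h3 := mfderiv_comp_apply_of_eq (ζ.proj z) h2 h1 (height_vadd_sec σ z) v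
  have h4 : (ζ.proj ∘ fun x => height σ z +ᵥ (σ.val x).val) = id :=
    funext fun x => proj_vadd_sec σ _ x
  rw [h4, mfderiv_id] at h3
  exact h3.symm

theorem dfun_proj (f : M → ℝ) {z : Z} (hf : MDifferentiableAt I 𝓘(ℝ, ℝ) f (ζ.proj z)) (X : F) :
    dfun J (fun z => f (ζ.proj z)) z X = dfun I f (ζ.proj z) (dproj ζ z X) :=
  mvfderiv_comp_apply z hf (ζ.contMDiff_proj.mdifferentiable (by simp) z) X

theorem dproj_fundVF (z : Z) : dproj ζ z (fundVec J z) = 0 := by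
  have h1 : MDifferentiableAt 𝓘(ℝ, ℝ) J (fun r : ℝ => r +ᵥ z) 0 :=
    (contMDiff_orbit ζ z).mdifferentiable (by simp) 0
  have h2 : MDifferentiableAt J I ζ.proj z := ζ.contMDiff_proj.mdifferentiable (by simp) z
  have h3 := mfderiv_comp_apply_of_eq (0 : ℝ) h2 h1 (zero_vadd ℝ z) (1 : ℝ)
  have h4 : (ζ.proj ∘ fun r : ℝ => r +ᵥ z) = fun _ => ζ.proj z := funext fun r => ζ.proj_vadd r z
  rw [h4, mfderiv_const] at h3
  have h5 : dproj ζ z (fundVec J z)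
      = -(dproj ζ z (mfderiv 𝓘(ℝ, ℝ) J (fun r : ℝ => r +ᵥ z) 0 (1 : ℝ))) := map_neg (dproj ζ z) _
  rw [h5]
  refine neg_eq_zero.2 (h3.symm.trans rfl)

theorem mfderiv_vadd_sec (σ : ζ.Sec) (z : Z) (v : E) (w : ℝ) :
    (show F from mfderiv (I.prod 𝓘(ℝ, ℝ)) J (fun p : M × ℝ => p.2 +ᵥ (σ.val p.1).val)
      (ζ.proj z, height σ z) (v, w)) = lift σ z v - w • fundVec J z := by
  have h1 : MDifferentiableAt (I.prod 𝓘(ℝ, ℝ)) J (fun p : M × ℝ => p.2 +ᵥ (σ.val p.1).val)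
      (ζ.proj z, height σ z) := (contMDiff_vadd_sec σ).mdifferentiable (by simp) _
  have h2 := mfderiv_prod_eq_add_apply h1 (v := ((v, w) : E × ℝ))
  refine h2.trans ?_
  -- The orbit map based at `σ(ζ z)` is the one based at `z` with its parameter shifted by the
  -- height, so its derivative at `height σ z` is the derivative at `0` that defines `X_Z`.
  have h3 : (fun r : ℝ => r +ᵥ (σ.val (ζ.proj z)).val)
      = (fun r : ℝ => r +ᵥ z) ∘ fun r => r - height σ z := by
    funext r
    conv_rhs => rw [Function.comp_apply, ← height_vadd_sec σ z, ← add_vadd, height_vadd_sec,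
      sub_add_cancel]
  have h4 : HasMFDerivAt 𝓘(ℝ, ℝ) 𝓘(ℝ, ℝ) (fun r : ℝ => r - height σ z) (height σ z)
      (ContinuousLinearMap.id ℝ ℝ) :=
    ((hasFDerivAt_id (height σ z)).sub_const _).hasMFDerivAt
  have h5 : MDifferentiableAt 𝓘(ℝ, ℝ) J (fun r : ℝ => r +ᵥ z) 0 :=
    (contMDiff_orbit ζ z).mdifferentiable (by simp) 0
  have h6 := mfderiv_comp_apply_of_eq (height σ z) h5 h4.mdifferentiableAt (sub_self _) w
  rw [← h3, h4.mfderiv] at h6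
  have h7 : -(w • fundVec J z)
      = mfderiv 𝓘(ℝ, ℝ) J (fun r : ℝ => r +ᵥ z) 0 w := by
    have := map_smul (mfderiv 𝓘(ℝ, ℝ) J (fun r : ℝ => r +ᵥ z) 0) w (1 : ℝ)
    rw [smul_eq_mul, mul_one] at this
    refine Eq.trans ?_ this.symm
    change -(w • -_) = _
    rw [smul_neg, neg_neg]
    rfl
  rw [sub_eq_add_neg, h7]
  exact congrArg (fun x : F => lift σ z v + x) h6

/-- Differentiating the identity `z = height σ z +ᵥ σ (ζ z)` splits a tangent vector into its
horizontal and vertical parts. -/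
theorem eq_lift_sub (σ : ζ.Sec) (z : Z) (X : F) :
    X = lift σ z (dproj ζ z X) - (dfun J (height σ) z X) • fundVec J z := by
  have h1 : MDifferentiableAt J I ζ.proj z := ζ.contMDiff_proj.mdifferentiable (by simp) z
  have h2 : MDifferentiableAt J 𝓘(ℝ, ℝ) (height σ) z :=
    (contMDiff_height σ).mdifferentiable (by simp) z
  have h3 := mfderiv_comp_apply z (g := fun p : M × ℝ => p.2 +ᵥ (σ.val p.1).val)
    (f := fun z => (ζ.proj z, height σ z))
    ((contMDiff_vadd_sec σ).mdifferentiable (by simp) _) (h1.prodMk h2) X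
  have h4 : ((fun p : M × ℝ => p.2 +ᵥ (σ.val p.1).val) ∘ fun z => (ζ.proj z, height σ z)) = id :=
    funext fun z => height_vadd_sec σ z
  rw [h4, mfderiv_id] at h3
  refine h3.trans ?_
  rw [mfderiv_prodMk h1 h2]
  exact mfderiv_vadd_sec σ z _ _

theorem lift_vadd (σ : ζ.Sec) (r : ℝ) (z : Z) (v : E) :
    lift σ (r +ᵥ z) v = mfderiv J J (fun z : Z => r +ᵥ z) z (lift σ z v) := by
  have h1 : MDifferentiableAt I J (fun x => height σ z +ᵥ (σ.val x).val) (ζ.proj z) :=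
    (contMDiff_vadd_sec_left σ (height σ z)).mdifferentiable (by simp) _
  have h2 : MDifferentiableAt J J (fun z : Z => r +ᵥ z) z :=
    (contMDiff_vadd_const ζ r).mdifferentiable (by simp) z
  have h3 := mfderiv_comp_apply_of_eq (ζ.proj z) h2 h1 (height_vadd_sec σ z) v
  refine Eq.trans ?_ h3
  unfold lift
  rw [ζ.proj_vadd, height_vadd]
  have : (fun x => (r + height σ z) +ᵥ (σ.val x).val)
      = (fun z : Z => r +ᵥ z) ∘ fun x => height σ z +ᵥ (σ.val x).val :=
    funext fun x => add_vadd _ _ _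
  rw [this]
  rfl

/-- The group is commutative, so translations carry orbit maps to orbit maps. -/
theorem fundVF_vadd (ζ : AVBundle I J M Z) (r : ℝ) (z : Z) :
    fundVec J (r +ᵥ z) = mfderiv J J (fun z : Z => r +ᵥ z) z (fundVF J z) := by
  have h1 : MDifferentiableAt 𝓘(ℝ, ℝ) J (fun r : ℝ => r +ᵥ z) 0 :=
    (contMDiff_orbit ζ z).mdifferentiable (by simp) 0
  have h2 : MDifferentiableAt J J (fun z : Z => r +ᵥ z) z :=
    (contMDiff_vadd_const ζ r).mdifferentiable (by simp) z
  have h3 := mfderiv_comp_apply_of_eq (0 : ℝ) h2 h1 (zero_vadd ℝ z) (1 : ℝ)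
  have h4 : ((fun z : Z => r +ᵥ z) ∘ fun t : ℝ => t +ᵥ z) = fun t : ℝ => t +ᵥ (r +ᵥ z) :=
    funext fun t => vadd_comm _ _ _
  rw [h4] at h3
  have h5 := map_neg (mfderiv J J (fun z : Z => r +ᵥ z) z)
    (mfderiv 𝓘(ℝ, ℝ) J (fun r : ℝ => r +ᵥ z) 0 (1 : ℝ))
  refine Eq.trans ?_ h5.symm
  exact congrArg (fun x : F => -x) h3

end

section

/-! ### Linear coordinates on the fibres of `RZ` -/

theorem lift_invariant (σ : ζ.Sec) {m : M} (a b : ζ.Fiber m) (v : E) :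
    lift σ b.val v = mfderiv J J (fun z : Z => (b -ᵥ a : ℝ) +ᵥ z) a.val (lift σ a.val v) := by
  rw [← lift_vadd, fiber_vsub_vadd_val]

theorem fundVF_invariant {m : M} (a b : ζ.Fiber m) : fundVec J b.val
    = mfderiv J J (fun z : Z => (b -ᵥ a : ℝ) +ᵥ z) a.val (fundVF J a.val) := by
  rw [← fundVF_vadd ζ, fiber_vsub_vadd_val]

/-- The invariant field `v + w X_Z` along a fibre, where `v` is lifted horizontally. -/
def invField (σ : ζ.Sec) (m : M) : (E × ℝ) →ₗ[ℝ] ζ.atiyah m where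
  toFun p := ⟨fun a => lift σ a.val p.1 + p.2 • fundVec J a.val, fun a b => by
    have h1 := map_add (mfderiv J J (fun z : Z => (b -ᵥ a : ℝ) +ᵥ z) a.val)
      (lift σ a.val p.1) (p.2 • fundVec J a.val)
    have h2 := map_smul (mfderiv J J (fun z : Z => (b -ᵥ a : ℝ) +ᵥ z) a.val)
      p.2 (fundVec J a.val)
    refine Eq.trans ?_ h1.symm
    refine congrArg₂ (fun x y : F => x + y) (lift_invariant σ a b p.1) ?_
    refine Eq.trans ?_ h2.symm
    exact congrArg (fun x : F => p.2 • x) (fundVF_invariant a b)⟩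
  map_add' p q := Subtype.ext <| funext fun a => by
    change lift σ a.val (p.1 + q.1) + (p.2 + q.2) • fundVec J a.val
      = (lift σ a.val p.1 + p.2 • fundVec J a.val)
        + (lift σ a.val q.1 + q.2 • fundVec J a.val)
    rw [map_add]
    module
  map_smul' c p := Subtype.ext <| funext fun a => by
    change lift σ a.val (c • p.1) + (c • p.2) • fundVec J a.val
      = c • (lift σ a.val p.1 + p.2 • fundVec J a.val)
    rw [map_smul, smul_eq_mul]
    module

/-- An invariant field along `Z_m` is determined by its value at `σ m`, and there `eq_lift_sub`
supplies the components. -/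
theorem invField_surjective (σ : ζ.Sec) (m : M) : Function.Surjective (invField σ m) := by
  intro X
  let a := σ.val m
  let X' : F := X.1 a
  refine ⟨(dproj ζ a.val X', -dfun J (height σ) a.val X'), Subtype.ext <| funext fun b => ?_⟩
  refine Eq.trans ?_ (X.2 a b).symm
  have h1 := eq_lift_sub σ a.val X'
  have h2 := (invField σ m (dproj ζ a.val X', -dfun J (height σ) a.val X')).2 a b
  refine h2.trans (congrArg _ ?_)
  refine Eq.trans ?_ h1.symm
  exact (congrArg (fun x : F => lift σ a.val _ + x) (neg_smul _ _)).trans (sub_eq_add_neg _ _).symm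

/-- The linear coordinates on `(RZ)_m` given by a section `σ`: `(v, α, β, γ)` stands for the
operator `v + (α + β F_σ) X_Z + γ`, where `v` is lifted horizontally. -/
def coordMap (σ : ζ.Sec) (m : M) : (E × ℝ × ℝ × ℝ) →ₗ[ℝ] ζ.RZ m where
  -- The choice `ψ = -γ F_σ` has slope `γ`, hence yields the constant `γ`; the summand `γ F_σ` of
  -- `φ` cancels the vertical field that this `ψ` brings along.
  toFun c := ζ.mkR m (invField σ m (c.1, c.2.1),
    (c.2.2.1 + c.2.2.2) • ζ.fiberF (σ.val m), -c.2.2.2 • ζ.fiberF (σ.val m))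
  map_add' c d := by
    rw [← map_add]
    congr 1
    refine Prod.ext ?_ (Prod.ext ?_ ?_)
    · exact map_add (invField σ m) (c.1, c.2.1) (d.1, d.2.1)
    · simp only [Prod.fst_add, Prod.snd_add]; module
    · simp only [Prod.snd_add]; module
  map_smul' r c := by
    rw [RingHom.id_apply, ← map_smul]
    congr 1
    refine Prod.ext ?_ (Prod.ext ?_ ?_)
    · exact map_smul (invField σ m) r (c.1, c.2.1)
    · simp only [Prod.smul_fst, Prod.smul_snd, smul_eq_mul]; module
    · simp only [Prod.smul_snd, smul_eq_mul]; module

theorem coordMap_fst (σ : ζ.Sec) {m : M} (c : E × ℝ × ℝ × ℝ) (a : ζ.Fiber m) :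
    (coordMap σ m c).1.1 a = lift σ a.val c.1
      + (c.2.1 - c.2.2.1 * height σ a.val) • fundVec J a.val := by
  change (lift σ a.val c.1 + c.2.1 • fundVec J a.val)
    + ((c.2.2.1 + c.2.2.2) * (σ.val m -ᵥ a) + -c.2.2.2 * (σ.val m -ᵥ a))
      • fundVec J a.val = _
  rw [height_val, ← neg_vsub_eq_vsub_rev a (σ.val m)]
  module

theorem coordMap_snd (σ : ζ.Sec) {m : M} (c : E × ℝ × ℝ × ℝ) :
    (coordMap σ m c).1.2 = c.2.2.2 := by
  change (-c.2.2.2) * (-1 : ℝ) = _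
  ring

theorem affine_fiber_apply (σ : ζ.Sec) {m : M} (φ : ζ.Fiber m →ᵃ[ℝ] ℝ) (a : ζ.Fiber m) :
    φ a = φ (σ.val m) + φ.linear 1 * height σ a.val := by
  have h := φ.map_vadd (σ.val m) (a -ᵥ σ.val m : ℝ)
  rw [vsub_vadd] at h
  rw [h, height_val]
  have h2 := φ.linear.map_smul (a -ᵥ σ.val m : ℝ) 1
  rw [smul_eq_mul, mul_one] at h2
  rw [h2, vadd_eq_add, smul_eq_mul]
  ring

/-- The triple `(X, φ, ψ)` enters only through these combinations, which absorb the identification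
of the distinguished sections. Surjectivity of the coordinates and all the membership tests below
rest on this formula. -/
theorem mkR_invField (σ : ζ.Sec) (m : M) (p : E × ℝ) (φ ψ : ζ.Fiber m →ᵃ[ℝ] ℝ) :
    ζ.mkR m (invField σ m p, φ, ψ) = coordMap σ m (p.1, p.2 + φ (σ.val m) + ψ (σ.val m),
      -(φ.linear 1 + ψ.linear 1), ψ.linear 1) := by
  refine Subtype.ext (Prod.ext (funext fun a => ?_) ?_)
  · rw [coordMap_fst]
    change (lift σ a.val p.1 + p.2 • fundVec J a.val)
      + (φ a + ψ a) • fundVec J a.val = _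
    rw [affine_fiber_apply σ φ a, affine_fiber_apply σ ψ a]
    module
  · rw [coordMap_snd]
    rfl

/-- The projection to `M` recovers `v`, the vertical component at the heights `0` and `1` recovers
`α` and `β`, and the constant term is `γ`. -/
theorem coordMap_injective (σ : ζ.Sec) (m : M) : Function.Injective (coordMap σ m) := by
  rw [injective_iff_map_eq_zero]
  intro c hc
  have h1 : ∀ r : ℝ, lift σ (r +ᵥ (σ.val m).val) c.1
      + (c.2.1 - c.2.2.1 * r) • fundVec J (r +ᵥ (σ.val m).val) = 0 := by
    intro r
    have := coordMap_fst σ c (r +ᵥ σ.val m)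
    rw [hc, fiber_vadd_val, height_sec] at this
    exact this.symm
  have h2 : c.1 = 0 := by
    have := congrArg (dproj ζ ((0 : ℝ) +ᵥ (σ.val m).val)) (h1 0)
    rw [map_add, map_smul, dproj_lift, dproj_fundVF] at this
    simpa using this
  have h3 : ∀ r : ℝ, c.2.1 - c.2.2.1 * r = 0 := by
    intro r
    have := congrArg (dfun J (height σ) (r +ᵥ (σ.val m).val)) (h1 r)
    rw [map_add, map_smul, dfun_height_lift, dfun_height_fundVF] at this
    simpa [sub_eq_zero, eq_comm] using this
  have h4 := coordMap_snd σ (m := m) c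
  rw [hc] at h4
  have h5 := h3 0
  have h6 := h3 1
  refine Prod.ext h2 (Prod.ext ?_ (Prod.ext ?_ h4.symm)) <;>
    simp only [Prod.fst_zero, Prod.snd_zero] <;> linarith

theorem coordMap_surjective (σ : ζ.Sec) (m : M) : Function.Surjective (coordMap σ m) := by
  rintro ⟨R, ⟨X, φ, ψ⟩, rfl⟩
  obtain ⟨p, rfl⟩ := invField_surjective σ m X
  exact ⟨_, (mkR_invField σ m p φ ψ).symm⟩

/-- The coordinates as a linear equivalence. -/
def coord (σ : ζ.Sec) (m : M) : (E × ℝ × ℝ × ℝ) ≃ₗ[ℝ] ζ.RZ m :=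
  LinearEquiv.ofBijective (coordMap σ m) ⟨coordMap_injective σ m, coordMap_surjective σ m⟩

theorem coord_fst (σ : ζ.Sec) {m : M} (c : E × ℝ × ℝ × ℝ) (a : ζ.Fiber m) :
    (coord σ m c).1.1 a = lift σ a.val c.1
      + (c.2.1 - c.2.2.1 * height σ a.val) • fundVec J a.val :=
  coordMap_fst σ c a

theorem phi1_coord (σ : ζ.Sec) {m : M} (c : E × ℝ × ℝ × ℝ) :
    ζ.phi1 m (coord σ m c) = c.2.2.2 :=
  coordMap_snd σ c

theorem mkR_invField_eq_coord (σ : ζ.Sec) (m : M) (p : E × ℝ) (φ ψ : ζ.Fiber m →ᵃ[ℝ] ℝ) :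
    ζ.mkR m (invField σ m p, φ, ψ) = coord σ m (p.1, p.2 + φ (σ.val m) + ψ (σ.val m),
      -(φ.linear 1 + ψ.linear 1), ψ.linear 1) :=
  mkR_invField σ m p φ ψ

/-! ### Equations of the five subbundles in coordinates -/

theorem fiberF_linear {m : M} (a : ζ.Fiber m) : (ζ.fiberF a).linear 1 = -1 := rfl

theorem fiberF_apply {m : M} (a b : ζ.Fiber m) : ζ.fiberF a b = a -ᵥ b := rfl

/-- Written with `⊥` so that it unfolds to membership of the last three coordinates in the kernel of
a projection, as `isVectorSubbundle_TTilde` uses it. -/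
theorem coord_mem_TTilde (σ : ζ.Sec) {m : M} (c : E × ℝ × ℝ × ℝ) :
    coord σ m c ∈ ζ.TTilde m ↔ c.2.2 ∈ (⊥ : Submodule ℝ (ℝ × ℝ)) := by
  rw [Submodule.mem_bot]
  constructor
  · rintro ⟨⟨X, φ, ψ⟩, ⟨-, hφ, hψ⟩, h⟩
    obtain rfl : φ = 0 := hφ
    obtain rfl : ψ = 0 := hψ
    obtain ⟨p, rfl⟩ := invField_surjective σ m X
    rw [mkR_invField_eq_coord] at h
    rw [← (coord σ m).injective h]
    simp
  · intro h
    refine ⟨(invField σ m (c.1, c.2.1), 0, 0), ⟨trivial, rfl, rfl⟩, ?_⟩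
    rw [mkR_invField_eq_coord]
    congr 1
    refine Prod.ext rfl (Prod.ext ?_ ?_)
    · simp
    · rw [h]; simp

theorem coord_mem_LBreve (σ : ζ.Sec) {m : M} (c : E × ℝ × ℝ × ℝ) :
    coord σ m c ∈ ζ.LBreve m ↔ c.2.2.2 = 0 := by
  constructor
  · rintro ⟨⟨X, φ, ψ⟩, ⟨-, -, hψ⟩, h⟩
    obtain rfl : ψ = 0 := hψ
    obtain ⟨p, rfl⟩ := invField_surjective σ m X
    rw [mkR_invField_eq_coord] at h
    rw [← (coord σ m).injective h]
    simp
  · intro h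
    refine ⟨(invField σ m (c.1, c.2.1), c.2.2.1 • ζ.fiberF (σ.val m), 0),
      ⟨trivial, trivial, rfl⟩, ?_⟩
    rw [mkR_invField_eq_coord]
    congr 1
    refine Prod.ext rfl (Prod.ext ?_ (Prod.ext ?_ h.symm))
    · simp [fiberF_apply]
    · simp [fiberF_linear]

theorem coord_mem_LTilde (σ : ζ.Sec) {m : M} (c : E × ℝ × ℝ × ℝ) :
    coord σ m c ∈ ζ.LTilde m ↔ c.2.2.1 + c.2.2.2 = 0 := by
  constructor
  · rintro ⟨⟨X, φ, ψ⟩, ⟨-, hφ, -⟩, h⟩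
    obtain rfl : φ = 0 := hφ
    obtain ⟨p, rfl⟩ := invField_surjective σ m X
    rw [mkR_invField_eq_coord] at h
    rw [← (coord σ m).injective h]
    simp
  · intro h
    refine ⟨(invField σ m (c.1, c.2.1), 0, -c.2.2.2 • ζ.fiberF (σ.val m)),
      ⟨trivial, rfl, trivial⟩, ?_⟩
    rw [mkR_invField_eq_coord]
    congr 1
    refine Prod.ext rfl (Prod.ext ?_ (Prod.ext ?_ ?_))
    · simp [fiberF_apply]
    · simp [fiberF_linear]; linarith
    · simp [fiberF_linear]

/-- The functions `F_a` and `F_σ` differ by the constant `a - σ(m)` along the fibre, so the choice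
of `a` affects only `α`, and `a = σ(m)` may be taken. -/
theorem coord_mem_TBar (σ : ζ.Sec) {m : M} (c : E × ℝ × ℝ × ℝ) :
    coord σ m c ∈ ζ.TBar m ↔ c.2.2 = (1, 0) := by
  constructor
  · rintro ⟨X, a, h⟩
    obtain ⟨p, rfl⟩ := invField_surjective σ m X
    rw [mkR_invField_eq_coord] at h
    rw [(coord σ m).injective h]
    simp [fiberF_linear]
  · intro h
    refine ⟨invField σ m (c.1, c.2.1), σ.val m, ?_⟩
    rw [mkR_invField_eq_coord]
    congr 1
    refine Prod.ext rfl (Prod.ext ?_ (h.trans ?_))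
    · simp [fiberF_apply]
    · simp [fiberF_linear]

theorem coord_mem_LBar (σ : ζ.Sec) {m : M} (c : E × ℝ × ℝ × ℝ) :
    coord σ m c ∈ ζ.LBar m ↔ c.2.2.1 + c.2.2.2 = 1 := by
  constructor
  · rintro ⟨X, a, ψ, h⟩
    obtain ⟨p, rfl⟩ := invField_surjective σ m X
    rw [mkR_invField_eq_coord] at h
    rw [(coord σ m).injective h]
    simp [fiberF_linear]
  · intro h
    refine ⟨invField σ m (c.1, c.2.1), σ.val m, -c.2.2.2 • ζ.fiberF (σ.val m), ?_⟩
    rw [mkR_invField_eq_coord]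
    congr 1
    refine Prod.ext rfl (Prod.ext ?_ (Prod.ext ?_ ?_))
    · simp [fiberF_apply]
    · simp [fiberF_linear]; linarith
    · simp [fiberF_linear]

/-! ### The operator with given coordinates -/

/-- The coordinates of a section of `RZ`. -/
def coords (σ : ζ.Sec) (R : ∀ m, ζ.RZ m) (m : M) : E × ℝ × ℝ × ℝ := (coord σ m).symm (R m)

theorem coord_coords (σ : ζ.Sec) (R : ∀ m, ζ.RZ m) (m : M) : coord σ m (coords σ R m) = R m :=
  (coord σ m).apply_symm_apply _

theorem coords_coord (σ : ζ.Sec) (c : M → E × ℝ × ℝ × ℝ) :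
    coords σ (fun m => coord σ m (c m)) = c :=
  funext fun m => (coord σ m).symm_apply_apply _

theorem toOp_fst (σ : ζ.Sec) (R : ∀ m, ζ.RZ m) (z : Z) :
    (ζ.toOp R).1 z = lift σ z (coords σ R (ζ.proj z)).1 + ((coords σ R (ζ.proj z)).2.1
      - (coords σ R (ζ.proj z)).2.2.1 * height σ z) • fundVec J z := by
  change (R (ζ.proj z)).1.1 (ζ.pt z) = _
  rw [← coord_coords σ R (ζ.proj z)]
  exact coord_fst σ _ _

theorem toOp_snd (σ : ζ.Sec) (R : ∀ m, ζ.RZ m) (z : Z) :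
    (ζ.toOp R).2 z = (coords σ R (ζ.proj z)).2.2.2 := by
  rw [← phi1_coord σ, coord_coords]
  rfl

theorem toOp_act (σ : ζ.Sec) (R : ∀ m, ζ.RZ m) (f : Z → ℝ) (z : Z) :
    (ζ.toOp R).act f z = dfun J f z (lift σ z (coords σ R (ζ.proj z)).1)
      + ((coords σ R (ζ.proj z)).2.1 - (coords σ R (ζ.proj z)).2.2.1 * height σ z)
        * dfun J f z (fundVec J z) + (coords σ R (ζ.proj z)).2.2.2 * f z := by
  rw [Op.act, toOp_snd σ, toOp_fst σ]
  congr 1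
  exact (map_add (dfun J f z) _ _).trans (congrArg _ (map_smul (dfun J f z) _ _))

theorem toOp_injective (ζ : AVBundle I J M Z) : Function.Injective ζ.toOp := by
  intro R R' h
  funext m
  refine Subtype.ext (Prod.ext (funext fun a => ?_) ?_)
  · obtain ⟨z, rfl⟩ := a
    exact congrFun (congrArg Prod.fst h) z
  · obtain ⟨z, rfl⟩ := (inferInstance : Nonempty (ζ.Fiber m))
    exact congrFun (congrArg Prod.snd h) z

end

section

/-! ### Smoothness in coordinates -/

variable (I) in
/-- Smoothness of a vector field on a set. -/
abbrev SmoothVF [IsManifold I ∞ M] (V : M → E) (U : Set M) : Prop :=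
  ContMDiffOn I I.tangent ∞ (fun m => (⟨m, V m⟩ : TangentBundle I M)) U

theorem tangentBundle_mk_congr {x y : M} {v w : E} (h : x = y) (h' : v = w) :
    (⟨x, v⟩ : TangentBundle I M) = ⟨y, w⟩ := by
  subst h h'
  rfl

section
variable [IsManifold I ∞ M]

theorem SmoothVF.dfun {V : M → E} {U : Set M} (hV : SmoothVF I V U) {f : M → ℝ}
    (hf : ContMDiff I 𝓘(ℝ, ℝ) ∞ f) :
    ContMDiffOn I 𝓘(ℝ, ℝ) ∞ (fun m => dfun I f m (V m)) U := by
  have h1 : ContMDiff I.tangent 𝓘(ℝ, ℝ).tangent ∞ (tangentMap I 𝓘(ℝ, ℝ) f) :=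
    hf.contMDiff_tangentMap (by simp)
  exact ((contMDiff_snd_tangentBundle_modelSpace ℝ 𝓘(ℝ, ℝ)).comp h1).comp_contMDiffOn hV

theorem smoothVF_zero (U : Set M) : SmoothVF I (fun _ => 0) U :=
  (Bundle.contMDiff_zeroSection ℝ (TangentSpace I : M → Type _)).contMDiffOn

end

variable [IsManifold I ∞ M] [IsManifold J ∞ Z]

/-- Smoothness of a section of `RZ` in the coordinates given by a section of `Z`. -/
def SmoothCoords (I : ModelWithCorners ℝ E H) [IsManifold I ∞ M] (U : Set M)
    (c : M → E × ℝ × ℝ × ℝ) : Prop :=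
  SmoothVF I (fun m => (c m).1) U ∧ ContMDiffOn I 𝓘(ℝ, ℝ × ℝ × ℝ) ∞ (fun m => (c m).2) U

/-- This field is the image of the field `(v, w)` on `M × ℝ` under the tangent map of `(x, r) ↦ r +ᵥ
σ x`, by `mfderiv_vadd_sec`. -/
theorem smoothVF_lift_add (σ : ζ.Sec) {U : Set M} {v : M → E} (hv : SmoothVF I v U) {w : Z → ℝ}
    (hw : ContMDiffOn J 𝓘(ℝ, ℝ) ∞ w (ζ.proj ⁻¹' U)) :
    SmoothVF J (fun z => lift σ z (v (ζ.proj z)) - w z • fundVec J z) (ζ.proj ⁻¹' U) := by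
  have : IsManifold I 1 M := IsManifold.of_le (n := ∞) (by simp)
  have h1 : ContMDiffOn J I.tangent ∞
      (fun z => (⟨ζ.proj z, v (ζ.proj z)⟩ : TangentBundle I M)) (ζ.proj ⁻¹' U) :=
    hv.comp ζ.contMDiff_proj.contMDiffOn fun z hz => hz
  have h2 : ContMDiffOn J 𝓘(ℝ, ℝ).tangent ∞
      (fun z => (⟨height σ z, w z⟩ : TangentBundle 𝓘(ℝ, ℝ) ℝ)) (ζ.proj ⁻¹' U) := by
    intro z hz
    refine Bundle.contMDiffWithinAt_totalSpace.2 ⟨(contMDiff_height σ) z |>.contMDiffWithinAt, ?_⟩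
    refine (hw z hz).congr (fun y _ => ?_) ?_ <;> simp
  have h3 := ((contMDiff_vadd_sec σ).contMDiff_tangentMap (m := ∞) (by simp)).comp
    (contMDiff_equivTangentBundleProd_symm (I := I) (I' := 𝓘(ℝ, ℝ)) (M := M) (M' := ℝ))
  refine (h3.comp_contMDiffOn (h1.prodMk h2)).congr fun z _ => ?_
  exact tangentBundle_mk_congr (height_vadd_sec σ z).symm
    (mfderiv_vadd_sec σ z (v (ζ.proj z)) (w z)).symm

theorem smoothVF_dproj (σ : ζ.Sec) {U : Set M} {X : Z → F} (hX : SmoothVF J X (ζ.proj ⁻¹' U)) :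
    SmoothVF I (fun m => dproj ζ (σ.val m).val (X (σ.val m).val)) U := by
  have h1 := (ζ.contMDiff_proj.contMDiff_tangentMap (m := ∞) (by simp)).comp_contMDiffOn hX
  have h2 : ContMDiffOn I J ∞ (fun m => (σ.val m).val) U := σ.smooth.contMDiffOn
  refine (h1.comp h2 fun m hm => ?_).congr fun m _ => ?_
  · change ζ.proj _ ∈ U
    rw [(σ.val m).proj_val]
    exact hm
  · exact tangentBundle_mk_congr (σ.val m).proj_val.symm rfl

/-- From a smooth operator the coordinates are recovered by smooth operations: project the field to
`M` along `σ`, and restrict its derivative of the height and its constant term to translates of `σ`.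
The converse is `smoothVF_lift_add`. -/
theorem smoothOnR_iff (σ : ζ.Sec) (U : Set M) (R : ∀ m, ζ.RZ m) :
    ζ.SmoothOnR U R ↔ SmoothCoords I U (coords σ R) := by
  have hp : ContMDiffOn J I ∞ ζ.proj (ζ.proj ⁻¹' U) := ζ.contMDiff_proj.contMDiffOn
  have hs : ∀ r : ℝ, ContMDiffOn I J ∞ (fun m => r +ᵥ (σ.val m).val) U :=
    fun r => (contMDiff_vadd_sec_left σ r).contMDiffOn
  have hsm : ∀ r : ℝ, Set.MapsTo (fun m => r +ᵥ (σ.val m).val) U (ζ.proj ⁻¹' U) :=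
    fun r m hm => by
      change ζ.proj _ ∈ U
      rwa [proj_vadd_sec]
  constructor
  · rintro ⟨hX, hh⟩
    have hX : SmoothVF J (ζ.toOp R).1 (ζ.proj ⁻¹' U) := hX
    have e1 : ∀ z, dproj ζ z ((ζ.toOp R).1 z) = (coords σ R (ζ.proj z)).1 := by
      intro z
      rw [toOp_fst σ]
      exact (map_add (dproj ζ z) _ _).trans (by
        rw [map_smul, dproj_fundVF, dproj_lift, smul_zero, add_zero])
    have e2 : ∀ z, dfun J (height σ) z ((ζ.toOp R).1 z) = -((coords σ R (ζ.proj z)).2.1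
        - (coords σ R (ζ.proj z)).2.2.1 * height σ z) := by
      intro z
      rw [toOp_fst σ]
      exact (map_add (dfun J (height σ) z) _ _).trans (by
        rw [map_smul, dfun_height_fundVF, dfun_height_lift, smul_eq_mul, mul_neg_one, zero_add])
    have h1 := smoothVF_dproj σ hX
    have h2 := hX.dfun (contMDiff_height σ)
    have h3 : ∀ r : ℝ, ContMDiffOn I 𝓘(ℝ, ℝ) ∞
        (fun m => -((coords σ R m).2.1 - (coords σ R m).2.2.1 * r)) U := by
      intro r
      refine (h2.comp (hs r) (hsm r)).congr fun m _ => ?_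
      rw [Function.comp_apply, e2, proj_vadd_sec, height_sec]
    have h4 : ContMDiffOn I 𝓘(ℝ, ℝ) ∞ (fun m => (coords σ R m).2.2.2) U := by
      refine (hh.comp (hs 0) (hsm 0)).congr fun m _ => ?_
      rw [Function.comp_apply, toOp_snd σ, proj_vadd_sec]
    refine ⟨h1.congr fun m _ => tangentBundle_mk_congr rfl ?_, ?_⟩
    · exact ((e1 _).trans (by rw [(σ.val m).proj_val])).symm
    -- At height `r` the derivative of the height is `-α + β r`: the value at `r = 0` gives `α`, the
    -- difference of the values at `1` and `0` gives `β`.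
    · refine ContMDiffOn.prodMk_space ((h3 0).neg.congr fun m _ => ?_)
        (ContMDiffOn.prodMk_space (((h3 1).sub (h3 0)).congr fun m _ => ?_) h4)
      · simp
      · simp
  · rintro ⟨hv, hc⟩
    have hα : ContMDiffOn I 𝓘(ℝ, ℝ) ∞ (fun m => (coords σ R m).2.1) U :=
      contDiff_fst.contMDiff.comp_contMDiffOn hc
    have hβ : ContMDiffOn I 𝓘(ℝ, ℝ) ∞ (fun m => (coords σ R m).2.2.1) U :=
      (contDiff_fst.comp contDiff_snd).contMDiff.comp_contMDiffOn hc
    have hγ : ContMDiffOn I 𝓘(ℝ, ℝ) ∞ (fun m => (coords σ R m).2.2.2) U :=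
      (contDiff_snd.comp contDiff_snd).contMDiff.comp_contMDiffOn hc
    constructor
    · have hw : ContMDiffOn J 𝓘(ℝ, ℝ) ∞ (fun z => -((coords σ R (ζ.proj z)).2.1
          - (coords σ R (ζ.proj z)).2.2.1 * height σ z)) (ζ.proj ⁻¹' U) :=
        ((hα.comp hp fun _ h => h).sub
          ((hβ.comp hp fun _ h => h).mul (contMDiff_height σ).contMDiffOn)).neg
      refine (smoothVF_lift_add σ hv hw).congr fun z _ => tangentBundle_mk_congr rfl ?_
      rw [toOp_fst σ]
      module
    · refine (hγ.comp hp fun _ h => h).congr fun z _ => ?_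
      rw [toOp_snd σ]
      rfl

theorem smoothOnR_coord_iff (σ : ζ.Sec) (U : Set M) (c : M → E × ℝ × ℝ × ℝ) :
    ζ.SmoothOnR U (fun m => coord σ m (c m)) ↔ SmoothCoords I U c := by
  rw [smoothOnR_iff σ, coords_coord]

theorem contMDiff_act {D : Op J Z} (hD : D.SmoothOn Set.univ) {f : Z → ℝ}
    (hf : ContMDiff J 𝓘(ℝ, ℝ) ∞ f) : ContMDiff J 𝓘(ℝ, ℝ) ∞ (D.act f) := by
  have h1 : SmoothVF J D.1 Set.univ := hD.1
  exact contMDiffOn_univ.1 ((h1.dfun hf).add (hD.2.mul hf.contMDiffOn))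

theorem smoothVF_fundVec (σ : ζ.Sec) : SmoothVF J (fundVec J : Z → F) Set.univ := by
  have h := smoothVF_lift_add σ (smoothVF_zero (I := I) Set.univ)
    (w := fun _ => -1) contMDiffOn_const
  refine h.congr fun z _ => tangentBundle_mk_congr rfl ?_
  simp

theorem smoothOn_opX (σ : ζ.Sec) : (opX J Z).SmoothOn Set.univ :=
  ⟨smoothVF_fundVec σ, contMDiffOn_const⟩

end

section

/-! ### Frames -/

variable [IsManifold I ∞ M] [IsManifold J ∞ Z] [FiniteDimensional ℝ E]

theorem smoothVF_sum_localFrame_iff {ι : Type*} [Fintype ι] (b : Module.Basis ι ℝ E) (m : M)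
    {W : Set M} (hW : IsOpen W)
    (hWU : W ⊆ (trivializationAt E (TangentSpace I : M → Type _) m).baseSet) (c : ι → M → ℝ) :
    SmoothVF I (fun x => ∑ i, c i x • (show E from
      (trivializationAt E (TangentSpace I : M → Type _) m).localFrame b i x)) W ↔
      ∀ i, ContMDiffOn I 𝓘(ℝ, ℝ) ∞ (c i) W := by
  have : ContMDiffVectorBundle 1 E (TangentSpace I : M → Type _) I :=
    ContMDiffVectorBundle.of_le (n := ∞) (by simp)
  set t := trivializationAt E (TangentSpace I : M → Type _) m
  let s : ∀ x : M, TangentSpace I x := fun x => ∑ i, c i x • t.localFrame b i x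
  have hs : ∀ x ∈ W, ∀ i, t.localFrameCoeff I b i x (s x) = c i x := by
    intro x hx i
    rw [t.localFrameCoeff_apply_of_mem_baseSet b (hWU hx)]
    have : s x = ∑ i, c i x • t.basisAt b (hWU hx) i :=
      Finset.sum_congr rfl fun i _ => by rw [t.localFrame_apply_of_mem_baseSet b (hWU hx)]
    rw [this, Module.Basis.repr_sum_self]
  refine Iff.trans (contMDiffOn_iff_localFrameCoeff (s := s) (k := ∞) b hW hWU) ?_
  exact forall_congr' fun i => contMDiffOn_congr fun x hx => hs x hx i

/-- In coordinates `S` is `TM × K` with `K` constant, so a local frame of `TM` and a basis of `K`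
form a frame. The clause on coefficients is what `IsVectorBundleR` asks for; the case `K = ⊤` gives
`RZ` itself. -/
theorem exists_frame (σ : ζ.Sec) (K : Submodule ℝ (ℝ × ℝ × ℝ)) {S : ∀ m, Submodule ℝ (ζ.RZ m)}
    (hS : ∀ m c, coord σ m c ∈ S m ↔ c.2 ∈ K) (m : M) :
    ∃ U : Set M, IsOpen U ∧ m ∈ U ∧ ∃ (k : ℕ) (e : Fin k → ∀ m, ζ.RZ m), ζ.IsFrame S U e ∧
      ∀ W ⊆ U, IsOpen W → ∀ (c : Fin k → M → ℝ) (R : ∀ m, ζ.RZ m),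
        (∀ x ∈ W, R x = ∑ i, c i x • e i x) →
          (ζ.SmoothOnR W R ↔ ∀ i, ContMDiffOn I 𝓘(ℝ, ℝ) ∞ (c i) W) := by
  let b := Module.finBasis ℝ E
  let kb := Module.finBasis ℝ K
  let t := trivializationAt E (TangentSpace I : M → Type _) m
  let v : Fin (Module.finrank ℝ E) → M → E := fun i x => t.localFrame b i x
  let B : M → Fin (Module.finrank ℝ E) ⊕ Fin (Module.finrank ℝ K) → E × (ℝ × ℝ × ℝ) := fun x =>
    Sum.elim (LinearMap.inl ℝ E (ℝ × ℝ × ℝ) ∘ fun i => v i x)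
      (LinearMap.inr ℝ E (ℝ × ℝ × ℝ) ∘ fun j => (kb j : ℝ × ℝ × ℝ))
  let e : Fin (Module.finrank ℝ E + Module.finrank ℝ K) → ∀ m, ζ.RZ m :=
    fun i x => coord σ x (B x (finSumFinEquiv.symm i))
  have hl := t.isLocalFrameOn_localFrame_baseSet I ∞ b
  have hkbs : Submodule.span ℝ (Set.range fun j => (kb j : ℝ × ℝ × ℝ)) = K := by
    have := congrArg (Submodule.map K.subtype) kb.span_eq
    rwa [Submodule.map_span, ← Set.range_comp, Submodule.map_top, Submodule.range_subtype] at this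
  have hkbl : LinearIndependent ℝ (fun j => (kb j : ℝ × ℝ × ℝ)) :=
    kb.linearIndependent.map' K.subtype K.ker_subtype
  have hcoeff : ∀ W ⊆ t.baseSet, IsOpen W → ∀ (c : Fin _ → M → ℝ) (R : ∀ m, ζ.RZ m),
      (∀ x ∈ W, R x = ∑ i, c i x • e i x) →
        (ζ.SmoothOnR W R ↔ ∀ i, ContMDiffOn I 𝓘(ℝ, ℝ) ∞ (c i) W) := by
    intro W hWU hW c R hR
    have h0 : ∀ x ∈ W, coords σ R x = ∑ s, c (finSumFinEquiv s) x • B x s := by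
      intro x hx
      rw [coords, hR x hx, map_sum, ← finSumFinEquiv.sum_comp]
      refine Finset.sum_congr rfl fun s _ => ?_
      rw [map_smul, LinearEquiv.symm_apply_apply, Equiv.symm_apply_apply]
    have h1 : ∀ x ∈ W, (coords σ R x).1 = ∑ i, c (finSumFinEquiv (Sum.inl i)) x • v i x := by
      intro x hx
      rw [h0 x hx, Fintype.sum_sum_type, Prod.fst_add, Prod.fst_sum, Prod.fst_sum]
      simp [B]
    have h2 : ∀ x ∈ W, (coords σ R x).2
        = ∑ j, c (finSumFinEquiv (Sum.inr j)) x • (kb j : ℝ × ℝ × ℝ) := by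
      intro x hx
      rw [h0 x hx, Fintype.sum_sum_type, Prod.snd_add, Prod.snd_sum, Prod.snd_sum]
      simp [B]
    have h3 : ContMDiffOn I 𝓘(ℝ, ℝ × ℝ × ℝ) ∞ (fun x => (coords σ R x).2) W ↔
        ∀ j, ContMDiffOn I 𝓘(ℝ, ℝ) ∞ (c (finSumFinEquiv (Sum.inr j))) W := by
      constructor
      · intro h j
        -- A linear retraction of `ℝ³` onto `K` makes the coefficients in the basis of `K`
        -- restrictions of continuous linear functionals on `ℝ³`.
        obtain ⟨P, hP⟩ := K.subtype.exists_leftInverse_of_injective K.ker_subtype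
        let L : ℝ × ℝ × ℝ →L[ℝ] ℝ := LinearMap.toContinuousLinearMap (kb.coord j ∘ₗ P)
        refine (L.contMDiff.comp_contMDiffOn h).congr fun x hx => ?_
        have hp : ∀ k : K, P (k : ℝ × ℝ × ℝ) = k := fun k => LinearMap.congr_fun hP k
        change _ = kb.coord j (P (coords σ R x).2)
        rw [h2 x hx, map_sum, map_sum]
        simp [hp, Finsupp.single_apply]
      · intro h
        let L : (Fin (Module.finrank ℝ K) → ℝ) →L[ℝ] ℝ × ℝ × ℝ :=
          LinearMap.toContinuousLinearMap
            (Fintype.linearCombination ℝ fun j => (kb j : ℝ × ℝ × ℝ))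
        refine (L.contMDiff.comp_contMDiffOn (contMDiffOn_pi_space.2 h)).congr fun x hx => ?_
        rw [h2 x hx]
        rfl
    have h4 : SmoothVF I (fun x => (coords σ R x).1) W ↔
        ∀ i, ContMDiffOn I 𝓘(ℝ, ℝ) ∞ (c (finSumFinEquiv (Sum.inl i))) W :=
      (contMDiffOn_congr fun x hx => tangentBundle_mk_congr rfl (h1 x hx)).trans
        (smoothVF_sum_localFrame_iff b m hW hWU fun i => c (finSumFinEquiv (Sum.inl i)))
    rw [smoothOnR_iff σ, SmoothCoords, h3, h4, ← finSumFinEquiv.forall_congr_right, Sum.forall]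
  refine ⟨t.baseSet, t.open_baseSet, FiberBundle.mem_baseSet_trivializationAt' m, _, e,
    ⟨fun i => ?_, fun x hx => ⟨?_, ?_⟩⟩, hcoeff⟩
  -- The frame is smooth by the criterion just proved, since its own coefficients are constants `0`
  -- and `1`.
  · refine (hcoeff _ subset_rfl t.open_baseSet (fun j _ => if j = i then 1 else 0) (e i)
      fun x _ => ?_).2 fun j => contMDiffOn_const
    simp
  · have h1 : LinearIndependent ℝ (B x) :=
      linearIndependent_inl_union_inr' (hl.linearIndependent hx) hkbl
    exact (h1.comp _ finSumFinEquiv.symm.injective).map' _ (coord σ x).ker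
  · have h1 : Submodule.span ℝ (Set.range (B x)) = Submodule.prod ⊤ K := by
      rw [Set.Sum.elim_range, Set.range_comp, Set.range_comp, LinearMap.span_inl_union_inr, hkbs]
      congr 1
      exact top_le_iff.1 (hl.generating hx)
    have h2 : (Set.range fun i => e i x) = coord σ x '' Set.range (B x) := by
      rw [← Set.range_comp, ← finSumFinEquiv.symm.surjective.range_comp]
      rfl
    rw [h2, ← LinearEquiv.coe_coe, ← Submodule.map_span, h1]
    ext R
    constructor
    · rintro ⟨c, hc, rfl⟩
      exact (hS x c).2 hc.2
    · intro hR
      obtain ⟨c, rfl⟩ := (coord σ x).surjective R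
      exact ⟨c, ⟨trivial, (hS x c).1 hR⟩, rfl⟩

end

section

/-! ### Commutation with `X_Z` -/

theorem opX_act (f : Z → ℝ) (z : Z) : (opX J Z).act f z = dfun J f z (fundVec J z) := by
  change dfun J f z (fundVec J z) + 0 * f z = _
  rw [zero_mul, add_zero]

theorem hasDerivAt_vadd (ζ : AVBundle I J M Z) {f : Z → ℝ} (hf : ContMDiff J 𝓘(ℝ, ℝ) ∞ f)
    (r : ℝ) (z : Z) : HasDerivAt (fun r : ℝ => f (r +ᵥ z)) (-(opX J Z).act f (r +ᵥ z)) r := by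
  rw [opX_act]
  exact hasDerivAt_orbit_at ζ r (hf.mdifferentiable (by simp) _)

theorem opX_act_eq (ζ : AVBundle I J M Z) {f : Z → ℝ} (hf : ContMDiff J 𝓘(ℝ, ℝ) ∞ f) {z : Z}
    {f' : ℝ} (h : HasDerivAt (fun r : ℝ => f (r +ᵥ z)) f' 0) : (opX J Z).act f z = -f' := by
  have h1 := hasDerivAt_vadd ζ hf 0 z
  rw [zero_vadd] at h1
  rw [← h1.unique h, neg_neg]

/-- A smooth function annihilated by `X_Z` is constant along the fibres. -/
theorem vadd_eq_of_opX_act_eq_zero (ζ : AVBundle I J M Z) {f : Z → ℝ}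
    (hf : ContMDiff J 𝓘(ℝ, ℝ) ∞ f) (h : ∀ z, (opX J Z).act f z = 0) (r : ℝ) (z : Z) :
    f (r +ᵥ z) = f z := by
  have h1 := is_const_of_deriv_eq_zero (f := fun r : ℝ => f (r +ᵥ z))
    (fun r => (hasDerivAt_vadd ζ hf r z).differentiableAt)
    (fun r => by rw [(hasDerivAt_vadd ζ hf r z).deriv, h, neg_zero]) r 0
  simpa using h1

/-- A smooth function for which `X_Z f` is constant along the fibres is affine along them. -/
theorem vadd_eq_of_opX_act_vadd (ζ : AVBundle I J M Z) {f : Z → ℝ}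
    (hf : ContMDiff J 𝓘(ℝ, ℝ) ∞ f)
    (h : ∀ (r : ℝ) z, (opX J Z).act f (r +ᵥ z) = (opX J Z).act f z) (r : ℝ) (z : Z) :
    f (r +ᵥ z) = f z - r * (opX J Z).act f z := by
  have h0 : ∀ r, HasDerivAt (fun r : ℝ => f (r +ᵥ z) + r * (opX J Z).act f z) 0 r := by
    intro r
    have := (hasDerivAt_vadd ζ hf r z).add ((hasDerivAt_id r).mul_const ((opX J Z).act f z))
    rw [h, one_mul, neg_add_cancel] at this
    exact this
  have h1 := is_const_of_deriv_eq_zero (fun r => (h0 r).differentiableAt)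
    (fun r => (h0 r).deriv) r 0
  simp only [zero_vadd, zero_mul, add_zero] at h1
  linarith

theorem opX_act_height (σ : ζ.Sec) (z : Z) : (opX J Z).act (height σ) z = -1 := by
  rw [opX_act, dfun_height_fundVF]

theorem opX_act_const (ζ : AVBundle I J M Z) (c : ℝ) (z : Z) :
    (opX J Z).act (fun _ => c) z = 0 := by
  rw [opX_act_eq ζ contMDiff_const (hasDerivAt_const _ _), neg_zero]

theorem opX_act_proj (ζ : AVBundle I J M Z) {f : M → ℝ} (hf : ContMDiff I 𝓘(ℝ, ℝ) ∞ f) (z : Z) :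
    (opX J Z).act (fun z => f (ζ.proj z)) z = 0 := by
  rw [opX_act_eq ζ (f := fun z => f (ζ.proj z)) (hf.comp ζ.contMDiff_proj) (f' := 0), neg_zero]
  simp only [ζ.proj_vadd]
  exact hasDerivAt_const _ _

theorem dfun_eq_fderiv [I.Boundaryless] {f : M → ℝ} {m : M}
    (hf : MDifferentiableAt I 𝓘(ℝ, ℝ) f m) :
    dfun I f m = fderiv ℝ (fun y => f ((extChartAt I m).symm y)) (extChartAt I m m) := by
  refine hf.mvfderiv.trans ?_
  rw [I.range_eq_univ, fderivWithin_univ]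
  rfl

variable [IsManifold I ∞ M] [IsManifold J ∞ Z]

theorem contMDiff_opX_act (σ : ζ.Sec) {f : Z → ℝ} (hf : ContMDiff J 𝓘(ℝ, ℝ) ∞ f) :
    ContMDiff J 𝓘(ℝ, ℝ) ∞ ((opX J Z).act f) :=
  contMDiff_act (smoothOn_opX σ) hf

/-- Horizontal lifts commute with `X_Z`. -/
theorem hasDerivAt_dfun_lift [I.Boundaryless] (σ : ζ.Sec) {f : Z → ℝ}
    (hf : ContMDiff J 𝓘(ℝ, ℝ) ∞ f) (z : Z) (v : E) :
    HasDerivAt (fun r : ℝ => dfun J f (r +ᵥ z) (lift σ (r +ᵥ z) v))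
      (-dfun J ((opX J Z).act f) z (lift σ z v)) 0 := by
  set m := ζ.proj z with hm
  set h := height σ z with hh
  set y₀ := extChartAt I m m with hy₀
  -- This is `f` in a chart of `M` and the fibre coordinate measured from `z`, so that `(y₀, 0)`
  -- stands for `z`. A horizontal lift differentiates the first variable, `-X_Z` the second.
  let k : E × ℝ → ℝ := fun p => f ((p.2 + h) +ᵥ (σ.val ((extChartAt I m).symm p.1)).val)
  have hk : ContDiffAt ℝ ∞ k (y₀, 0) := by
    have h1 : ContMDiffAt 𝓘(ℝ, E) I ∞ (extChartAt I m).symm y₀ :=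
      (contMDiffOn_extChartAt_symm m).contMDiffAt (extChartAt_target_mem_nhds m)
    have h2 : ContMDiffAt 𝓘(ℝ, E × ℝ) I ∞ (fun p : E × ℝ => (extChartAt I m).symm p.1) (y₀, 0) :=
      ContMDiffAt.comp (y₀, (0 : ℝ)) h1 contDiff_fst.contMDiff.contMDiffAt
    have h3 : ContMDiffAt 𝓘(ℝ, E × ℝ) 𝓘(ℝ, ℝ) ∞ (fun p : E × ℝ => p.2 + h) (y₀, 0) :=
      (contDiff_snd.add contDiff_const).contMDiff.contMDiffAt
    exact ((hf.comp (contMDiff_vadd_sec σ)).contMDiffAt.comp (y₀, (0 : ℝ))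
      (h2.prodMk h3)).contDiffAt
  have hk' : DifferentiableAt ℝ (fderiv ℝ k) (y₀, 0) :=
    (hk.fderiv_right (m := 1) (by rw [one_add_one_eq_two]; exact ENat.LEInfty.out)).differentiableAt (by simp)
  have hkd : ∀ᶠ p in nhds (y₀, (0 : ℝ)), DifferentiableAt ℝ k p :=
    ((hk.of_le (m := 1) (by simp)).eventually (by simp)).mono fun p hp =>
      hp.differentiableAt (by simp)
  have hL : ∀ᶠ r in nhds (0 : ℝ),
      dfun J f (r +ᵥ z) (lift σ (r +ᵥ z) v) = fderiv ℝ k (y₀, r) (v, 0) := by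
    have hc : Filter.Tendsto (fun r : ℝ => (y₀, r)) (nhds 0) (nhds (y₀, 0)) :=
      (Continuous.prodMk_right y₀).tendsto 0
    filter_upwards [hc.eventually hkd] with r hr
    rw [dfun_lift σ (hf.mdifferentiable (by simp) _), ζ.proj_vadd, height_vadd, ← hm, ← hh,
      dfun_eq_fderiv (f := fun x => f ((r + h) +ᵥ (σ.val x).val))
        ((hf.comp (contMDiff_vadd_sec_left σ (r + h))).mdifferentiable (by simp) m)]
    have h1 : HasFDerivAt (fun y : E => k (y, r))
        ((fderiv ℝ k (y₀, r)).comp (ContinuousLinearMap.inl ℝ E ℝ)) y₀ :=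
      HasFDerivAt.comp (g := k) (f := fun y => (y, r)) y₀ hr.hasFDerivAt
        (hasFDerivAt_prodMk_left y₀ r)
    exact congrArg (fun T : E →L[ℝ] ℝ => T v) h1.fderiv
  have hR : dfun J ((opX J Z).act f) z (lift σ z v)
      = -fderiv ℝ (fderiv ℝ k) (y₀, 0) (v, 0) (0, 1) := by
    have hXf := contMDiff_opX_act σ hf
    rw [dfun_lift σ (hXf.mdifferentiable (by simp) _), ← hm, ← hh,
      dfun_eq_fderiv (f := fun x => (opX J Z).act f (h +ᵥ (σ.val x).val))
        ((hXf.comp (contMDiff_vadd_sec_left σ h)).mdifferentiable (by simp) m)]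
    have h1 : (fun y => (opX J Z).act f (h +ᵥ (σ.val ((extChartAt I m).symm y)).val))
        =ᶠ[nhds y₀] fun y => -fderiv ℝ k (y, 0) (0, 1) := by
      have hc : Filter.Tendsto (fun y : E => (y, (0 : ℝ))) (nhds y₀) (nhds (y₀, 0)) :=
        (Continuous.prodMk_left (0 : ℝ)).tendsto y₀
      filter_upwards [hc.eventually hkd] with y hy
      apply opX_act_eq ζ hf
      have h2 := (HasFDerivAt.comp (0 : ℝ) hy.hasFDerivAt
        (hasFDerivAt_prodMk_right y (0 : ℝ))).hasDerivAt
      refine (h2.congr_deriv (by simp)).congr_of_eventuallyEq (.of_forall fun r => ?_)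
      simp only [k, Function.comp_apply, add_vadd]
    have h2 : HasFDerivAt (fun y : E => fderiv ℝ k (y, 0))
        ((fderiv ℝ (fderiv ℝ k) (y₀, 0)).comp (ContinuousLinearMap.inl ℝ E ℝ)) y₀ :=
      HasFDerivAt.comp y₀ hk'.hasFDerivAt (hasFDerivAt_prodMk_left y₀ 0)
    have h3 := (h2.clm_apply (hasFDerivAt_const ((0 : E), (1 : ℝ)) y₀)).neg
    have h4 := (h3.congr_of_eventuallyEq h1).fderiv
    refine (congrArg (fun T : E →L[ℝ] ℝ => T v) h4).trans ?_
    simp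
  -- Both sides are mixed second derivatives of `k`, taken in opposite orders.
  have hsymm := (hk.isSymmSndFDerivAt (n := ∞) (by simpa using ENat.LEInfty.out)).eq (v, 0) (0, 1)
  rw [hR, neg_neg, hsymm]
  have h2 : HasFDerivAt (fun r : ℝ => fderiv ℝ k (y₀, r))
      ((fderiv ℝ (fderiv ℝ k) (y₀, 0)).comp (ContinuousLinearMap.inr ℝ E ℝ)) 0 :=
    HasFDerivAt.comp (0 : ℝ) hk'.hasFDerivAt (hasFDerivAt_prodMk_right y₀ (0 : ℝ))
  have h3 := (h2.clm_apply (hasFDerivAt_const ((v : E), (0 : ℝ)) (0 : ℝ))).hasDerivAt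
  exact (h3.congr_deriv (by simp)).congr_of_eventuallyEq hL

/-- `X_Z ∘ R = R ∘ X_Z + β X_Z`, where `β` is the third coordinate of `R`. -/
theorem opX_act_toOp_act [I.Boundaryless] (σ : ζ.Sec) {R : ∀ m, ζ.RZ m}
    (hR : ζ.SmoothOnR Set.univ R) {f : Z → ℝ} (hf : ContMDiff J 𝓘(ℝ, ℝ) ∞ f) (z : Z) :
    (opX J Z).act ((ζ.toOp R).act f) z = (ζ.toOp R).act ((opX J Z).act f) z
      + (coords σ R (ζ.proj z)).2.2.1 * (opX J Z).act f z := by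
  have hXf := contMDiff_opX_act σ hf
  have h1 := hasDerivAt_dfun_lift σ hf z (coords σ R (ζ.proj z)).1
  have h2 := hasDerivAt_vadd ζ hXf 0 z
  have h3 := hasDerivAt_vadd ζ hf 0 z
  -- The coordinates of `R` are constant along the orbit; only the factor `height σ (r +ᵥ z) = r +
  -- height σ z` varies, and its derivative produces the term `β X_Z f`.
  have h4 := (hasDerivAt_id (0 : ℝ)).add_const (height σ z)
  have h5 := (h1.add (((h4.const_mul (coords σ R (ζ.proj z)).2.2.1).const_sub
    (coords σ R (ζ.proj z)).2.1).mul h2)).add (h3.const_mul (coords σ R (ζ.proj z)).2.2.2)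
  have h6 := opX_act_eq ζ (contMDiff_act (J := J) hR hf) (z := z)
    (h5.congr_of_eventuallyEq (.of_forall fun r => by
      refine (toOp_act σ R f (r +ᵥ z)).trans ?_
      rw [ζ.proj_vadd, height_vadd, ← opX_act]
      rfl))
  rw [h6, toOp_act σ, ← opX_act]
  simp only [zero_vadd, id, zero_add]
  ring

/-- Each passage of `X_Z` through `R` adds one `β X_Z`, and `β`, being basic, commutes with `X_Z`.
Smoothness of the iterates is carried along because the next step of the induction needs it. -/
theorem iterate_opX_act_toOp_act [I.Boundaryless] (σ : ζ.Sec) {R : ∀ m, ζ.RZ m}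
    (hR : ζ.SmoothOnR Set.univ R) {f : Z → ℝ} (hf : ContMDiff J 𝓘(ℝ, ℝ) ∞ f) (n : ℕ) :
    ContMDiff J 𝓘(ℝ, ℝ) ∞ ((opX J Z).act^[n] f) ∧
    (opX J Z).act^[n] ((ζ.toOp R).act f) = fun z => (ζ.toOp R).act ((opX J Z).act^[n] f) z
      + n * ((coords σ R (ζ.proj z)).2.2.1 * (opX J Z).act^[n] f z) := by
  have hc := (smoothOnR_iff σ Set.univ R).1 hR
  have hβ : ContMDiff I 𝓘(ℝ, ℝ) ∞ (fun m => (coords σ R m).2.2.1) :=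
    (contDiff_fst.comp contDiff_snd).contMDiff.comp (contMDiffOn_univ.1 hc.2)
  induction n with
  | zero => exact ⟨hf, by simp⟩
  | succ n ih =>
    obtain ⟨ih1, ih2⟩ := ih
    have ih3 := contMDiff_opX_act σ ih1
    simp only [Function.iterate_succ_apply']
    refine ⟨ih3, ?_⟩
    rw [ih2]
    funext z
    have hD : ContMDiff J 𝓘(ℝ, ℝ) ∞ ((ζ.toOp R).act ((opX J Z).act^[n] f)) :=
      contMDiff_act (J := J) hR ih1
    have h1 := hasDerivAt_vadd ζ hD 0 z
    have h2 := hasDerivAt_vadd ζ ih1 0 z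
    have h3 := h1.add ((h2.const_mul (coords σ R (ζ.proj z)).2.2.1).const_mul (n : ℝ))
    have h4 : ContMDiff J 𝓘(ℝ, ℝ) ∞ fun z => (ζ.toOp R).act ((opX J Z).act^[n] f) z
        + n * ((coords σ R (ζ.proj z)).2.2.1 * (opX J Z).act^[n] f z) :=
      hD.add (contMDiff_const.mul ((hβ.comp ζ.contMDiff_proj).mul ih1))
    rw [opX_act_eq ζ h4 (h3.congr_of_eventuallyEq (.of_forall fun r => by
        simp only [Pi.add_apply, ζ.proj_vadd]))]
    rw [zero_vadd, opX_act_toOp_act σ hR ih1]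
    push_cast
    ring

/-- The operators given by smooth sections of `RZ` preserve the filtration. -/
theorem toOp_mem_D1ah [I.Boundaryless] (σ : ζ.Sec) {R : ∀ m, ζ.RZ m}
    (hR : ζ.SmoothOnR Set.univ R) : ζ.toOp R ∈ D1ah J Z := by
  refine ⟨hR, fun n f hf => ⟨contMDiff_act (J := J) hR hf.1, ?_⟩⟩
  rw [(iterate_opX_act_toOp_act σ hR hf.1 (n + 1)).2, hf.2]
  funext z
  rw [toOp_act σ]
  have : dfun J (0 : Z → ℝ) z = 0 := mvfderiv_zero
  rw [this]
  simp

end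

section

/-! ### Sections of `RZ` and affine-homogeneous operators -/

/-- An operator comes from `RZ` once its horizontal part and its constant term are basic and its
vertical part is affine along the fibres. Then `v`, `α`, `γ` are read off along `σ`, and `β` is the
slope `b`. -/
theorem exists_toOp_eq (σ : ζ.Sec) (X : Z → F) (h : Z → ℝ) (b : M → ℝ)
    (hp : ∀ (r : ℝ) z, dproj ζ (r +ᵥ z) (X (r +ᵥ z)) = dproj ζ z (X z))
    (hw : ∀ (r : ℝ) m, dfun J (height σ) (r +ᵥ (σ.val m).val) (X (r +ᵥ (σ.val m).val))
      = dfun J (height σ) (σ.val m).val (X (σ.val m).val) + r * b m)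
    (hh : ∀ (r : ℝ) z, h (r +ᵥ z) = h z) :
    ∃ R, ζ.toOp R = (X, h) ∧ coords σ R = fun m => (dproj ζ (σ.val m).val (X (σ.val m).val),
      -dfun J (height σ) (σ.val m).val (X (σ.val m).val), b m, h (σ.val m).val) := by
  refine ⟨fun m => coord σ m _, ?_, coords_coord σ _⟩
  refine Prod.ext (funext fun z => ?_) (funext fun z => ?_)
  · rw [toOp_fst σ, coords_coord]
    refine Eq.trans ?_ (eq_lift_sub σ z (X z)).symm
    have h1 := hp (height σ z) (σ.val (ζ.proj z)).val
    have h2 := hw (height σ z) (ζ.proj z)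
    rw [height_vadd_sec] at h1 h2
    rw [h1, h2]
    have : ∀ (A V : F) (w b h : ℝ), A + (-w - b * h) • V = A - (w + h * b) • V := by
      intros; module
    exact this ..
  · rw [toOp_snd σ, coords_coord]
    have h1 := hh (height σ z) (σ.val (ζ.proj z)).val
    rw [height_vadd_sec] at h1
    exact h1.symm

theorem act_proj (ζ : AVBundle I J M Z) (D : Op J Z) {f : M → ℝ} (hf : ContMDiff I 𝓘(ℝ, ℝ) ∞ f)
    (z : Z) : D.act (fun z => f (ζ.proj z)) z
      = dfun I f (ζ.proj z) (dproj ζ z (D.1 z)) + D.2 z * f (ζ.proj z) := by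
  let X : F := D.1 z
  exact congrArg (· + D.2 z * f (ζ.proj z)) 
    (dfun_proj f (hf.mdifferentiable (by simp) (ζ.proj z)) X)

theorem eq_of_dfun_eq [FiniteDimensional ℝ E] [IsManifold I ∞ M] [T2Space M] {m : M} {v w : E}
    (h : ∀ f : M → ℝ, ContMDiff I 𝓘(ℝ, ℝ) ∞ f → dfun I f m v = dfun I f m w) : v = w := by
  rw [SeparatingDual.eq_iff_forall_dual_eq (R := ℝ)]
  intro p
  obtain ⟨f, hf, hp, -⟩ := exists_smooth_jet (I := I) m p 0
  have := h f hf
  rwa [dfun, hp] at this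

/-- The projected vectors at `z` and at `r +ᵥ z` act equally on all smooth functions of `M`, and
these separate tangent vectors. -/
theorem dproj_vadd_of_act_proj [FiniteDimensional ℝ E] [IsManifold I ∞ M] [T2Space M]
    (ζ : AVBundle I J M Z) (D : Op J Z) (hh : ∀ (r : ℝ) z, D.2 (r +ᵥ z) = D.2 z)
    (hD : ∀ f : M → ℝ, ContMDiff I 𝓘(ℝ, ℝ) ∞ f → ∀ (r : ℝ) z,
      D.act (fun z => f (ζ.proj z)) (r +ᵥ z) = D.act (fun z => f (ζ.proj z)) z) (r : ℝ) (z : Z) :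
    dproj ζ (r +ᵥ z) (D.1 (r +ᵥ z)) = dproj ζ z (D.1 z) := by
  refine eq_of_dfun_eq (I := I) (m := ζ.proj z) fun f hf => ?_
  have := hD f hf r z
  rw [act_proj ζ D hf, act_proj ζ D hf, hh, ζ.proj_vadd] at this
  exact add_right_cancel this

theorem act_height (σ : ζ.Sec) (D : Op J Z) (z : Z) :
    D.act (height σ) z = dfun J (height σ) z (D.1 z) + D.2 z * height σ z := rfl

theorem act_const (D : Op J Z) (c : ℝ) (z : Z) : D.act (fun _ => c) z = D.2 z * c := by
  rw [Op.act, mvfderiv_const]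
  exact zero_add _

/-- The 1-form `φ⁰`, in coordinates. -/
def phi0 (σ : ζ.Sec) (m : M) : ζ.RZ m →ₗ[ℝ] ℝ :=
  -(LinearMap.fst ℝ ℝ ℝ ∘ₗ LinearMap.snd ℝ ℝ (ℝ × ℝ) ∘ₗ LinearMap.snd ℝ E (ℝ × ℝ × ℝ)) ∘ₗ
    (coord σ m).symm.toLinearMap

theorem phi0_eq (σ : ζ.Sec) (R : ∀ m, ζ.RZ m) (m : M) :
    phi0 σ m (R m) = -(coords σ R m).2.2.1 := rfl

theorem phi0_coord (σ : ζ.Sec) {m : M} (c : E × ℝ × ℝ × ℝ) :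
    phi0 σ m (coord σ m c) = -c.2.2.1 := by
  change -((coord σ m).symm (coord σ m c)).2.2.1 = _
  rw [LinearEquiv.symm_apply_apply]

theorem phi1_eq (σ : ζ.Sec) (R : ∀ m, ζ.RZ m) (m : M) :
    ζ.phi1 m (R m) = (coords σ R m).2.2.2 := by
  rw [← phi1_coord σ, coord_coords]

variable [IsManifold I ∞ M] [IsManifold J ∞ Z]

/-- Only `n = 0` and `n = 1` are used. The constant `1` and the basic functions lie in `Pol⁰`, which
makes `h` basic and `X` projectable; `height σ` lies in `Pol¹`, so its image is affine along the
fibres, and so is the vertical part of `X`. -/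
theorem exists_toOp_eq_of_mem_D1ah [FiniteDimensional ℝ E] [T2Space M] (σ : ζ.Sec) {D : Op J Z}
    (hD : D ∈ D1ah J Z) : ∃ R, ζ.toOp R = D := by
  obtain ⟨hs, hP⟩ := hD
  have h0 : ∀ f, ContMDiff J 𝓘(ℝ, ℝ) ∞ f → (∀ z, (opX J Z).act f z = 0) →
      ∀ (r : ℝ) z, D.act f (r +ᵥ z) = D.act f z := by
    intro f hf hf0
    obtain ⟨h1, h2⟩ := hP 0 f ⟨hf, funext hf0⟩
    exact vadd_eq_of_opX_act_eq_zero ζ h1 fun z => congrFun h2 z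
  have hh : ∀ (r : ℝ) z, D.2 (r +ᵥ z) = D.2 z := by
    intro r z
    have := h0 _ contMDiff_const (opX_act_const ζ 1) r z
    rwa [act_const, act_const, mul_one, mul_one] at this
  have hp := dproj_vadd_of_act_proj ζ D hh fun f hf =>
    h0 _ (hf.comp ζ.contMDiff_proj) (opX_act_proj ζ hf)
  have h1 : (opX J Z).act^[1 + 1] (height σ) = 0 := by
    have e : (opX J Z).act (height σ) = fun _ => -1 := funext (opX_act_height σ)
    rw [Function.iterate_succ_apply', Function.iterate_one, e]
    exact funext (opX_act_const ζ _)
  obtain ⟨h2, h3⟩ := hP 1 _ ⟨contMDiff_height σ, h1⟩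
  have h4 := vadd_eq_of_opX_act_vadd ζ h2
    (vadd_eq_of_opX_act_eq_zero ζ (contMDiff_opX_act σ h2) fun z => congrFun h3 z)
  obtain ⟨R, hR, -⟩ := exists_toOp_eq σ D.1 D.2
    -- The slope of `D (height σ)` along the fibre is `-X_Z (D (height σ))`; subtracting the slope
    -- `h` of `h · height σ` leaves that of the vertical part.
    (fun m => -(opX J Z).act (D.act (height σ)) (σ.val m).val - D.2 (σ.val m).val) hp
    (fun r m => by
      have h5 := h4 r (σ.val m).val
      have h6 := height_sec σ 0 m
      rw [zero_vadd] at h6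
      rw [act_height σ D (r +ᵥ _), act_height σ D (σ.val m).val, height_sec, hh, h6] at h5
      linear_combination h5) hh
  exact ⟨R, hR⟩

/-- If `X_Z f` is constant, then `X_Z (X f) = X (X_Z f) = 0`, so `X f` is constant along the fibres.
For basic `f` this makes `X` projectable; for `f = height σ` it makes the vertical part constant,
that is `β = 0`. -/
theorem exists_toOp_eq_of_mem_Xinv [FiniteDimensional ℝ E] [T2Space M] (σ : ζ.Sec) {D : Op J Z}
    (hD : D ∈ Xinv J Z) : ∃ R, ζ.toOp R = D ∧ ∀ m, R m ∈ ζ.TTilde m := by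
  obtain ⟨hs, hD2, hc⟩ := hD
  have h0 : ∀ c : ℝ, D.act (fun _ => c) = fun _ => 0 := fun c => funext fun z => by
    rw [act_const, hD2]; exact zero_mul c
  have h1 : ∀ f, ContMDiff J 𝓘(ℝ, ℝ) ∞ f → (∃ c : ℝ, ∀ z, (opX J Z).act f z = c) →
      ∀ (r : ℝ) z, D.act f (r +ᵥ z) = D.act f z := by
    rintro f hf ⟨c, hfc⟩
    refine vadd_eq_of_opX_act_eq_zero ζ (contMDiff_act hs hf) fun z => ?_
    have h2 := congrFun (hc f hf) z
    rw [Op.comm, show (opX J Z).act f = fun _ => c from funext hfc, h0, sub_zero] at h2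
    exact h2
  have hh : ∀ (r : ℝ) z, D.2 (r +ᵥ z) = D.2 z := fun r z => by rw [hD2]; rfl
  have hp := dproj_vadd_of_act_proj ζ D hh fun f hf =>
    h1 _ (hf.comp ζ.contMDiff_proj) ⟨0, opX_act_proj ζ hf⟩
  have h4 := h1 _ (contMDiff_height σ) ⟨-1, opX_act_height σ⟩
  obtain ⟨R, hR, hR'⟩ := exists_toOp_eq σ D.1 D.2 (fun _ => 0) hp
    (fun r m => by
      have h5 := h4 r (σ.val m).val
      rw [act_height, act_height, hD2] at h5
      simpa using h5) hh
  refine ⟨R, hR, fun m => ?_⟩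
  rw [← coord_coords σ R, coord_mem_TTilde, hR', hD2]
  exact Submodule.zero_mem _

theorem bijOn_toOp_D1ah [I.Boundaryless] [FiniteDimensional ℝ E] [T2Space M] (σ : ζ.Sec) :
    Set.BijOn ζ.toOp (ζ.SecR fun _ => Set.univ) (D1ah J Z) := by
  refine ⟨fun R hR => toOp_mem_D1ah σ hR.1, (toOp_injective ζ).injOn, fun D hD => ?_⟩
  obtain ⟨R, rfl⟩ := exists_toOp_eq_of_mem_D1ah σ hD
  exact ⟨R, ⟨hD.1, fun _ => trivial⟩, rfl⟩

theorem bijOn_toOp_Xah [I.Boundaryless] [FiniteDimensional ℝ E] [T2Space M] (σ : ζ.Sec) :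
    Set.BijOn ζ.toOp (ζ.SecR fun m => ζ.LBreve m) (Xah J Z) := by
  have key : ∀ R, (ζ.toOp R).2 = 0 ↔ ∀ m, R m ∈ ζ.LBreve m := by
    intro R
    constructor
    · intro h m
      rw [← coord_coords σ R, coord_mem_LBreve]
      have := congrFun h (σ.val m).val
      rwa [toOp_snd σ, (σ.val m).proj_val] at this
    · intro h
      funext z
      rw [toOp_snd σ]
      exact (coord_mem_LBreve σ _).1 ((coord_coords σ R _).symm ▸ h (ζ.proj z))
  refine ⟨fun R hR => ⟨toOp_mem_D1ah σ hR.1, (key R).2 hR.2⟩, (toOp_injective ζ).injOn,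
    fun D hD => ?_⟩
  obtain ⟨R, rfl⟩ := exists_toOp_eq_of_mem_D1ah σ hD.1
  exact ⟨R, ⟨hD.1.1, (key R).1 hD.2⟩, rfl⟩

theorem bijOn_toOp_Xinv [I.Boundaryless] [FiniteDimensional ℝ E] [T2Space M] (σ : ζ.Sec) :
    Set.BijOn ζ.toOp (ζ.SecR fun m => ζ.TTilde m) (Xinv J Z) := by
  refine ⟨fun R hR => ?_, (toOp_injective ζ).injOn, fun D hD => ?_⟩
  · have h : ∀ m, (coords σ R m).2.2 = 0 := fun m =>
      (coord_mem_TTilde σ _).1 ((coord_coords σ R m).symm ▸ hR.2 m)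
    refine ⟨hR.1, funext fun z => ?_, fun f hf => funext fun z => ?_⟩
    · rw [toOp_snd σ, h]
      rfl
    · rw [Op.comm, opX_act_toOp_act σ hR.1 hf, h]
      simp
  · obtain ⟨R, rfl, hR⟩ := exists_toOp_eq_of_mem_Xinv σ hD
    exact ⟨R, ⟨hD.1, hR⟩, rfl⟩

/-! ### The 1-forms `φ⁰` and `φ¹` -/

theorem isSmoothDual_phi1 (σ : ζ.Sec) : ζ.IsSmoothDual ζ.phi1 := by
  intro R hR
  have hc := contMDiffOn_univ.1 ((smoothOnR_iff σ Set.univ R).1 hR).2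
  simp only [phi1_eq σ]
  exact (contDiff_snd.comp contDiff_snd).contMDiff.comp hc

theorem isPhi0_phi0 [I.Boundaryless] (σ : ζ.Sec) : ζ.IsPhi0 (phi0 σ) := by
  refine ⟨fun R hR => ?_, fun R hR f hf z => ?_⟩
  · have hc := contMDiffOn_univ.1 ((smoothOnR_iff σ Set.univ R).1 hR).2
    simp only [phi0_eq]
    exact ((contDiff_fst.comp contDiff_snd).contMDiff.comp hc).neg
  · rw [Op.comm, opX_act_toOp_act σ hR hf, phi0_eq]
    ring

/-- Extend the vector locally and multiply by a bump function equal to `1` at `m`. -/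
theorem exists_smoothVF_eq [FiniteDimensional ℝ E] [T2Space M] (m : M) (v : E) :
    ∃ V : M → E, SmoothVF I V Set.univ ∧ V m = v := by
  obtain ⟨s, hs, hv⟩ := FiberBundle.exists_contMDiffOn_extend (I := I) (k := ∞) E
    (V := (TangentSpace I : M → Type _)) (x₀ := m) v
  obtain ⟨b, -, hb⟩ := (SmoothBumpFunction.nhds_basis_tsupport (I := I) m).mem_iff.1
    (interior_mem_nhds.2 hs)
  have h := ContMDiffOn.smul_section_of_tsupport (b.contMDiff.contMDiffOn (s := interior s))
    isOpen_interior hb (hv.mono interior_subset)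
  refine ⟨_, contMDiffOn_univ.2 h, ?_⟩
  rw [Pi.smul_apply', b.eq_one, one_smul]
  exact FiberBundle.extend_apply_self (E := (TangentSpace I : M → Type _)) E v

theorem exists_smoothOnR_eq [FiniteDimensional ℝ E] [T2Space M] (σ : ζ.Sec) {m : M} (R₀ : ζ.RZ m) :
    ∃ R, ζ.SmoothOnR Set.univ R ∧ R m = R₀ := by
  obtain ⟨c, rfl⟩ := (coord σ m).surjective R₀
  obtain ⟨V, hV, hVm⟩ := exists_smoothVF_eq (I := I) m c.1
  refine ⟨fun m => coord σ m (V m, c.2), (smoothOnR_coord_iff σ _ _).2 ⟨hV, contMDiffOn_const⟩, ?_⟩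
  exact congrArg (fun v => coord σ m (v, c.2)) hVm

/-- For uniqueness, every element of `(RZ)_m` extends to a global smooth section, and testing the
bracket identity on `height σ` determines the form because `X_Z (height σ) = -1` never vanishes. -/
theorem existsUnique_isPhi0 [I.Boundaryless] [FiniteDimensional ℝ E] [T2Space M] (σ : ζ.Sec) :
    ∃! φ, ζ.IsPhi0 φ := by
  refine ⟨phi0 σ, isPhi0_phi0 σ, fun φ hφ => funext fun m => LinearMap.ext fun R₀ => ?_⟩
  obtain ⟨R, hR, rfl⟩ := exists_smoothOnR_eq σ R₀
  have h1 := hφ.2 R hR _ (contMDiff_height σ) (σ.val m).val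
  rw [(isPhi0_phi0 σ).2 R hR _ (contMDiff_height σ), opX_act_height, (σ.val m).proj_val] at h1
  linarith

theorem mem_subbundles_iff [I.Boundaryless] [FiniteDimensional ℝ E] [T2Space M] (σ : ζ.Sec)
    {φ : ∀ m, ζ.RZ m →ₗ[ℝ] ℝ} (hφ : ζ.IsPhi0 φ) (m : M) (R : ζ.RZ m) :
    (R ∈ ζ.TTilde m ↔ φ m R = 0 ∧ ζ.phi1 m R = 0) ∧
    (R ∈ ζ.LTilde m ↔ ζ.phi1 m R - φ m R = 0) ∧
    (R ∈ ζ.LBreve m ↔ ζ.phi1 m R = 0) ∧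
    (R ∈ ζ.TBar m ↔ φ m R = -1 ∧ ζ.phi1 m R = 0) ∧
    (R ∈ ζ.LBar m ↔ ζ.phi1 m R - φ m R = 1) := by
  obtain rfl := (existsUnique_isPhi0 σ).unique hφ (isPhi0_phi0 σ)
  obtain ⟨c, rfl⟩ := (coord σ m).surjective R
  rw [coord_mem_TTilde, coord_mem_LTilde, coord_mem_LBreve, coord_mem_TBar, coord_mem_LBar,
    phi0_coord, phi1_coord, Submodule.mem_bot, Prod.ext_iff, Prod.ext_iff, sub_neg_eq_add,
    neg_eq_zero, neg_inj, add_comm c.2.2.2]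
  exact ⟨Iff.rfl, Iff.rfl, Iff.rfl, Iff.rfl, Iff.rfl⟩

end

section

/-! ### Smooth 1-forms -/

section forms
variable [IsManifold I ∞ M]

theorem isSmoothForm_mvfderiv {f : M → ℝ} (hf : ContMDiff I 𝓘(ℝ, ℝ) ∞ f) :
    IsSmoothForm (fun m => mvfderiv I f m) := by
  intro m₀
  refine (contMDiffAt_hom_bundle _).2 ⟨contMDiffAt_id, ?_⟩
  have h := (hf m₀).mfderiv_const (m := ∞) (by simp)
  refine h.congr_of_eventuallyEq (Filter.Eventually.of_forall fun m => ?_)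
  ext v
  simp [inTangentCoordinates, ContinuousLinearMap.inCoordinates, mvfderiv]
  rfl

theorem IsSmoothForm.apply {η : ∀ m : M, TangentSpace I m →L[ℝ] ℝ} (hη : IsSmoothForm η)
    {V : M → E} (hV : SmoothVF I V Set.univ) :
    ContMDiff I 𝓘(ℝ, ℝ) ∞ fun m => η m (V m) := by
  have hV' := contMDiffOn_univ.1 hV
  have h : ContMDiff I (I.prod 𝓘(ℝ, ℝ)) ∞ fun m =>
      (Bundle.TotalSpace.mk' ℝ m (η m (V m)) : Bundle.TotalSpace ℝ (Bundle.Trivial M ℝ)) :=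
    ContMDiff.clm_bundle_apply (E₁ := (TangentSpace I : M → Type _)) (E₂ := Bundle.Trivial M ℝ)
      (b := fun m : M => m) (v := V) hη hV'
  exact fun m => (Bundle.contMDiffAt_totalSpace.1 (h m)).2

/-- Chart coordinates, cut off by a bump function, serve as global test functions; near `m₀` their
derivatives along `V` are the components of `V` in the chart. -/
theorem smoothVF_of_dfun [FiniteDimensional ℝ E] [T2Space M] {V : M → E}
    (h : ∀ f : M → ℝ, ContMDiff I 𝓘(ℝ, ℝ) ∞ f →
      ContMDiff I 𝓘(ℝ, ℝ) ∞ fun m => dfun I f m (V m)) : SmoothVF I V Set.univ := by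
  refine contMDiffOn_univ.2 fun m₀ => ?_
  refine (Bundle.contMDiffAt_section (E := (TangentSpace I : M → Type _)) (s := V) m₀).2 ?_
  let b := Module.finBasis ℝ E
  let p : Fin _ → E →L[ℝ] ℝ := fun i => (b.coord i).toContinuousLinearMap
  obtain ⟨χ⟩ : Nonempty (SmoothBumpFunction I m₀) := inferInstance
  let f : Fin _ → M → ℝ := fun i x => χ x • p i (extChartAt I m₀ x)
  have hf : ∀ i, ContMDiff I 𝓘(ℝ, ℝ) ∞ (f i) := fun i =>
    χ.contMDiff_smul ((p i).contMDiff.comp_contMDiffOn contMDiffOn_extChartAt)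
  have key : ContMDiffAt I 𝓘(ℝ, E) ∞ (fun m => ∑ i, dfun I (f i) m (V m) • b i) m₀ :=
    ContMDiffAt.sum fun i _ => (h _ (hf i) m₀).smul contMDiffAt_const
  refine key.congr_of_eventuallyEq ?_
  -- The bump function must equal `1` on a neighbourhood of each nearby `m`, since differentials at
  -- `m` are compared.
  have hχ : ∀ᶠ m in nhds m₀, ∀ᶠ x in nhds m, χ x = 1 :=
    eventually_eventually_nhds.2 χ.eventuallyEq_one
  filter_upwards [hχ, (chartAt H m₀).open_source.mem_nhds (mem_chart_source H m₀)] with m hm hms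
  have hT : ∀ W : TangentSpace I m,
      (trivializationAt E (TangentSpace I : M → Type _) m₀ ⟨m, W⟩).2
        = mfderiv I 𝓘(ℝ, E) (extChartAt I m₀) m W := by
    intro W
    have h1 := DFunLike.congr_fun (TangentBundle.continuousLinearMapAt_trivializationAt hms) W
    refine Eq.trans ?_ h1
    exact (congrFun ((trivializationAt E (TangentSpace I : M → Type _) m₀).coe_linearMapAt_of_mem
      (R := ℝ) hms) W).symm
  have hd : ∀ i, dfun I (f i) m (V m) = p i (mfderiv I 𝓘(ℝ, E) (extChartAt I m₀) m (V m)) := by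
    intro i
    have h2 : HasMFDerivAt I 𝓘(ℝ, ℝ) (fun x => p i (extChartAt I m₀ x)) m
        ((p i).comp (mfderiv I 𝓘(ℝ, E) (extChartAt I m₀) m)) :=
      ((p i).hasMFDerivAt (x := extChartAt I m₀ m)).comp m
        (mdifferentiableAt_extChartAt hms).hasMFDerivAt
    have h3 : HasMFDerivAt I 𝓘(ℝ, ℝ) (f i) m
        ((p i).comp (mfderiv I 𝓘(ℝ, E) (extChartAt I m₀) m)) := by
      refine h2.congr_of_eventuallyEq ?_
      filter_upwards [hm] with x hx
      simp [f, hx]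
    simp only [dfun, mvfderiv]
    rw [h3.mfderiv]
    rfl
  refine (hT (V m)).trans ?_
  simp only [hd]
  exact (b.sum_repr _).symm

end forms

/-! ### Bidual -/

/-- A finite-dimensional space is its own bidual. -/
def bidual (E : Type*) [NormedAddCommGroup E] [NormedSpace ℝ E] [FiniteDimensional ℝ E] :
    ((E →L[ℝ] ℝ) →ₗ[ℝ] ℝ) ≃ₗ[ℝ] E :=
  (LinearMap.toContinuousLinearMap (𝕜 := ℝ) (E := E) (F' := ℝ)).dualMap.trans
    (Module.evalEquiv ℝ E).symm

theorem apply_bidual [FiniteDimensional ℝ E] (L : (E →L[ℝ] ℝ) →ₗ[ℝ] ℝ) (p : E →L[ℝ] ℝ) :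
    p (bidual E L) = L p := by
  have := Module.apply_evalEquiv_symm_apply ℝ E p.toLinearMap
    ((LinearMap.toContinuousLinearMap (𝕜 := ℝ) (E := E) (F' := ℝ)).dualMap L)
  refine this.trans ?_
  rw [LinearEquiv.dualMap_apply]
  congr 1

end

section

/-! ### Affine operators as sections of `RZ` -/

/-- Write `F_τ = (τ - σ) ∘ ζ - height σ` and differentiate. The terms in `height σ` cancel exactly
when `β + γ = 0`, the equation of `L̃Z`; for `β + γ = 1` they leave `-height σ`, as for a function
`F_t`. -/
theorem act_secF (σ τ : ζ.Sec) (R : ∀ m, ζ.RZ m) (z : Z) :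
    (ζ.toOp R).act (ζ.secF τ.val) z
      = dfun I (ζ.secDiff τ σ) (ζ.proj z) (coords σ R (ζ.proj z)).1
        + (coords σ R (ζ.proj z)).2.1 - (coords σ R (ζ.proj z)).2.2.1 * height σ z
        + (coords σ R (ζ.proj z)).2.2.2 * (ζ.secDiff τ σ (ζ.proj z) - height σ z) := by
  have hf := ζ.contMDiff_secDiff τ σ
  have h1 : ∀ X : F, dfun J (ζ.secF τ.val) z X
      = dfun I (ζ.secDiff τ σ) (ζ.proj z) (dproj ζ z X) - dfun J (height σ) z X := by
    intro X
    have e : ζ.secF τ.val = (fun z => ζ.secDiff τ σ (ζ.proj z)) - height σ :=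
      funext (secF_eq σ τ)
    have h2 : MDifferentiableAt J 𝓘(ℝ, ℝ) (fun z => ζ.secDiff τ σ (ζ.proj z)) z :=
      (hf.comp ζ.contMDiff_proj).mdifferentiable (by simp) z
    have h3 : dfun J (ζ.secF τ.val) z
        = dfun J (fun z => ζ.secDiff τ σ (ζ.proj z)) z - dfun J (height σ) z := by
      rw [e]
      exact mvfderiv_sub h2 ((contMDiff_height σ).mdifferentiable (by simp) z)
    refine (DFunLike.congr_fun h3 X).trans ?_
    exact congrArg (· - dfun J (height σ) z X)
      (dfun_proj _ (hf.mdifferentiable (by simp) (ζ.proj z)) X)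
  rw [toOp_act σ, h1, h1, dproj_lift, dproj_fundVF, dfun_height_lift, dfun_height_fundVF,
    map_zero, secF_eq σ]
  ring

theorem toOp_add_act (R R' : ∀ m, ζ.RZ m) (f : Z → ℝ) (z : Z) :
    (ζ.toOp fun m => R m + R' m).act f z = (ζ.toOp R).act f z + (ζ.toOp R').act f z := by
  have key : ∀ (X X' : F) (h h' : ℝ), dfun J f z (X + X') + (h + h') * f z
      = (dfun J f z X + h * f z) + (dfun J f z X' + h' * f z) := by
    intro X X' h h'
    rw [map_add]
    ring
  exact key _ _ _ _

theorem secF_eq_vsub (σ : ζ.Sec) (t : ∀ m, ζ.Fiber m) (z : Z) :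
    ζ.secF t z = (t (ζ.proj z) -ᵥ σ.val (ζ.proj z)) - height σ z := by
  rw [height, secF, vsub_sub_vsub_cancel_right]

theorem isSmoothSection_iff (σ : ζ.Sec) (t : ∀ m, ζ.Fiber m) :
    ζ.IsSmoothSection t ↔ ContMDiff I 𝓘(ℝ, ℝ) ∞ fun m => (t m -ᵥ σ.val m : ℝ) := by
  constructor
  · exact fun h => ζ.contMDiff_secDiff ⟨t, h⟩ σ
  · intro h
    have h1 := (ζ.secAdd σ _ h).smooth
    convert h1 using 1
    funext m
    exact (vsub_vadd _ _).symm

/-- An affine function is given by its linear part and its value at a point. -/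
def affineCoord {V P : Type*} [AddCommGroup V] [Module ℝ V] [AddTorsor V P] (p : P) :
    (P →ᵃ[ℝ] ℝ) ≃ₗ[ℝ] (V →ₗ[ℝ] ℝ) × ℝ where
  toFun D := (D.linear, D p)
  invFun c :=
    { toFun := fun q => c.1 (q -ᵥ p) + c.2
      linear := c.1
      map_vadd' := fun q v => by
        rw [vadd_vsub_assoc, map_add, vadd_eq_add, add_assoc] }
  map_add' _ _ := rfl
  map_smul' _ _ := rfl
  left_inv D := by
    refine AffineMap.ext_linear rfl (p := p) ?_
    simp
  right_inv c := by
    refine Prod.ext rfl ?_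
    simp

/-- The section `F_σ X_Z` of `RZ`. -/
def unitR (σ : ζ.Sec) (m : M) : ζ.RZ m := coord σ m (0, 0, 1, 0)

theorem unitR_act (σ τ : ζ.Sec) (z : Z) :
    (ζ.toOp (unitR σ)).act (ζ.secF τ.val) z = -height σ z := by
  rw [act_secF σ, show coords σ (unitR σ) = fun _ => (0, 0, 1, 0) from coords_coord σ _, map_zero]
  ring

theorem mem_TBar_iff (σ : ζ.Sec) {m : M} (R : ζ.RZ m) :
    R ∈ ζ.TBar m ↔ R - unitR σ m ∈ ζ.TTilde m := by
  obtain ⟨c, rfl⟩ := (coord σ m).surjective R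
  rw [unitR, ← map_sub, coord_mem_TBar, coord_mem_TTilde, Submodule.mem_bot]
  exact sub_eq_zero.symm

theorem mem_LBar_iff (σ : ζ.Sec) {m : M} (R : ζ.RZ m) :
    R ∈ ζ.LBar m ↔ R - unitR σ m ∈ ζ.LTilde m := by
  obtain ⟨c, rfl⟩ := (coord σ m).surjective R
  rw [unitR, ← map_sub, coord_mem_LBar, coord_mem_LTilde]
  simp only [Prod.fst_sub, Prod.snd_sub]
  constructor <;> intro h <;> linarith

section
variable [IsManifold J ∞ Z]

/-- Fibrewise bijectivity handles arbitrary sections, so that only the equivalence of the two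
notions of smoothness remains to be checked in each case. -/
theorem bijOn_secR {A : M → Type*} (Ψ : ∀ m, A m → ζ.RZ m) (S : ∀ m, Set (ζ.RZ m))
    (𝒟 : Set (∀ m, A m)) (hΨ : ∀ m, Function.Injective (Ψ m) ∧ Set.range (Ψ m) = S m)
    (hs : ∀ D, D ∈ 𝒟 ↔ ζ.SmoothOnR Set.univ fun m => Ψ m (D m)) :
    Set.BijOn (fun D m => Ψ m (D m)) 𝒟 (ζ.SecR S) := by
  refine ⟨fun D hD => ⟨(hs D).1 hD, fun m => (hΨ m).2 ▸ Set.mem_range_self _⟩, ?_, ?_⟩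
  · exact fun D _ D' _ h => funext fun m => (hΨ m).1 (congrFun h m)
  · rintro R ⟨hR, hRS⟩
    have : ∀ m, ∃ d, Ψ m d = R m := fun m => by
      have := hRS m
      rwa [← (hΨ m).2] at this
    choose D hD using this
    obtain rfl : (fun m => Ψ m (D m)) = R := funext hD
    exact ⟨D, (hs D).2 hR, rfl⟩

variable [IsManifold I ∞ M]

theorem smoothOnR_unitR (σ : ζ.Sec) (U : Set M) : ζ.SmoothOnR U (unitR σ) :=
  (smoothOnR_coord_iff σ U _).2 ⟨smoothVF_zero U, contMDiffOn_const⟩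

theorem smoothOnR_add_unitR (σ : ζ.Sec) (U : Set M) (R : ∀ m, ζ.RZ m) :
    ζ.SmoothOnR U (fun m => R m + unitR σ m) ↔ ζ.SmoothOnR U R := by
  have h : coords σ (fun m => R m + unitR σ m) = fun m => coords σ R m + (0, 0, 1, 0) := by
    funext m
    change (coord σ m).symm (R m + coord σ m _) = _
    rw [map_add, LinearEquiv.symm_apply_apply]
    rfl
  rw [smoothOnR_iff σ, smoothOnR_iff σ, h]
  refine and_congr ?_ ⟨fun h => ?_, fun h => ?_⟩
  · simp only [Prod.fst_add, add_zero]
  · refine (h.sub (contMDiffOn_const (c := ((0, 1, 0) : ℝ × ℝ × ℝ)))).congr fun m _ => ?_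
    simp
  · exact h.add (contMDiffOn_const (c := ((0, 1, 0) : ℝ × ℝ × ℝ)))

/-- An identification of affine functions with elements of `RZ` yields one of affine maps into the
fibres of `Z`. -/
theorem exists_affine_identification {V P : M → Type*} [∀ m, AddCommGroup (V m)]
    [∀ m, Module ℝ (V m)] [∀ m, AddTorsor (V m) (P m)] (σ : ζ.Sec) (smooth : (∀ m, P m) → Prop)
    (p : ζ.Sec → ∀ m, P m) {S : ∀ m, Submodule ℝ (ζ.RZ m)} {A : ∀ m, Set (ζ.RZ m)}
    (hA : ∀ m R, R ∈ A m ↔ R - unitR σ m ∈ S m) (Ψ : ∀ m, (P m →ᵃ[ℝ] ℝ) →ₗ[ℝ] ζ.RZ m)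
    (hΨ : ∀ m, Function.Injective (Ψ m) ∧ Set.range (Ψ m) = S m)
    (hs : ∀ D : ∀ m, P m →ᵃ[ℝ] ℝ,
      (∀ α, smooth α → ContMDiff I 𝓘(ℝ, ℝ) ∞ fun m => D m (α m)) ↔
        ζ.SmoothOnR Set.univ fun m => Ψ m (D m))
    (ha : ∀ (D : ∀ m, P m →ᵃ[ℝ] ℝ) (τ : ζ.Sec) (z : Z), D (ζ.proj z) (p τ (ζ.proj z)) =
      (ζ.toOp fun m => Ψ m (D m)).act (ζ.secF τ.val) z) :
    ∃ Ψ' : ∀ m, (P m →ᵃ[ℝ] ζ.Fiber m) →ᵃ[ℝ] ζ.RZ m,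
      (∀ m, Function.Injective (Ψ' m) ∧ Set.range (Ψ' m) = A m) ∧
      Set.BijOn (fun (D : ∀ m, P m →ᵃ[ℝ] ζ.Fiber m) m => Ψ' m (D m))
        {D | ∀ α, smooth α → ζ.IsSmoothSection fun m => D m (α m)} (ζ.SecR A) ∧
      ∀ (D : ∀ m, P m →ᵃ[ℝ] ζ.Fiber m) (τ : ζ.Sec) (z : Z), ζ.secF (fun m => D m (p τ m)) z =
        (ζ.toOp fun m => Ψ' m (D m)).act (ζ.secF τ.val) z := by
  -- Subtracting the constant map `σ(m)` turns a map into `Z_m` into a real function; adding `F_σ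
  -- X_Z` undoes this on the side of `RZ`.
  let c : ∀ m, P m →ᵃ[ℝ] ζ.Fiber m := fun m => AffineMap.const ℝ (P m) (σ.val m)
  let Ψ' : ∀ m, (P m →ᵃ[ℝ] ζ.Fiber m) →ᵃ[ℝ] ζ.RZ m := fun m =>
    { toFun := fun D => Ψ m (D -ᵥ c m) + unitR σ m
      linear := Ψ m
      map_vadd' := fun D L => by
        rw [vadd_vsub_assoc, map_add, vadd_eq_add, add_assoc] }
  have hΨ' : ∀ m D, Ψ' m D = Ψ m (D -ᵥ c m) + unitR σ m := fun _ _ => rfl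
  have h1 : ∀ m, Function.Injective (Ψ' m) ∧ Set.range (Ψ' m) = A m := by
    refine fun m => ⟨fun D D' h => vsub_left_injective (c m) ((hΨ m).1 (add_right_cancel h)), ?_⟩
    ext R
    rw [hA, ← SetLike.mem_coe, ← (hΨ m).2]
    constructor
    · rintro ⟨D, rfl⟩
      exact ⟨D -ᵥ c m, (add_sub_cancel_right _ _).symm⟩
    · rintro ⟨L, hL⟩
      refine ⟨L +ᵥ c m, ?_⟩
      rw [hΨ', vadd_vsub, hL, sub_add_cancel]
  refine ⟨Ψ', h1, bijOn_secR (fun m => Ψ' m) A _ h1 fun D => ?_, fun D τ z => ?_⟩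
  · refine Iff.trans ?_ (smoothOnR_add_unitR σ Set.univ fun m => Ψ m (D m -ᵥ c m)).symm
    rw [← hs]
    exact forall₂_congr fun α _ => isSmoothSection_iff σ _
  · refine Eq.trans ?_ (toOp_add_act (fun m => Ψ m (D m -ᵥ c m)) (unitR σ) _ z).symm
    -- With `t = D(τ)`, the function `F_t` is `(t - σ) ∘ ζ - height σ`: the first term is the action
    -- of `Ψ (D - σ)`, the second that of `F_σ X_Z`.
    rw [← ha, unitR_act, secF_eq_vsub σ, sub_eq_add_neg]
    rfl

end

end

/-! ### Affine functions on `PZ` and `CZ` in coordinates -/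

section

section
variable [FiniteDimensional ℝ E]

variable (I) in
/-- A linear function on `T*_m M` is a tangent vector. -/
def cotangentDual (m : M) : ((TangentSpace I m →L[ℝ] ℝ) →ₗ[ℝ] ℝ) ≃ₗ[ℝ] E := bidual E

theorem apply_cotangentDual {m : M} (L : (TangentSpace I m →L[ℝ] ℝ) →ₗ[ℝ] ℝ) (η : E →L[ℝ] ℝ) :
    η (cotangentDual I m L) = L η :=
  apply_bidual (E := E) L η

variable (I) in
/-- The coordinates of the element of `T̃Z` given by an affine function on `PZ`. -/
def derCoord (m : M) : ((TangentSpace I m →L[ℝ] ℝ) →ₗ[ℝ] ℝ) × ℝ →ₗ[ℝ] E × ℝ × ℝ × ℝ :=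
  (cotangentDual I m).toLinearMap.prodMap (LinearMap.inl ℝ ℝ (ℝ × ℝ))

theorem derCoord_apply {m : M} (c : ((TangentSpace I m →L[ℝ] ℝ) →ₗ[ℝ] ℝ) × ℝ) :
    derCoord I m c = (cotangentDual I m c.1, c.2, 0, 0) := rfl

variable (I) in
/-- The coordinates of the element of `L̃Z` given by an affine function on `CZ`. -/
def doCoord (m : M) :
    (((TangentSpace I m →L[ℝ] ℝ) × ℝ) →ₗ[ℝ] ℝ) × ℝ →ₗ[ℝ] E × ℝ × ℝ × ℝ where
  -- The coefficient of the value coordinate of `CZ` is `γ`, and `β = -γ` is the equation of `L̃Z`.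
  toFun c := (cotangentDual I m (c.1 ∘ₗ LinearMap.inl ℝ _ ℝ), c.2, -c.1 (0, 1), c.1 (0, 1))
  map_add' c d := by
    simp only [Prod.fst_add, Prod.snd_add, LinearMap.add_comp, map_add, LinearMap.add_apply,
      neg_add, Prod.mk_add_mk]
  map_smul' r c := by
    simp only [Prod.smul_fst, Prod.smul_snd, LinearMap.smul_comp, map_smul, LinearMap.smul_apply,
      ← smul_neg, Prod.smul_mk, RingHom.id_apply]

theorem doCoord_apply {m : M} (c : (((TangentSpace I m →L[ℝ] ℝ) × ℝ) →ₗ[ℝ] ℝ) × ℝ) :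
    doCoord I m c = (cotangentDual I m (c.1 ∘ₗ LinearMap.inl ℝ _ ℝ), c.2, -c.1 (0, 1), c.1 (0, 1)) :=
  rfl

theorem doCoord_injective (m : M) : Function.Injective (doCoord I m) := by
  intro c d h
  rw [doCoord_apply, doCoord_apply, Prod.mk.injEq, Prod.mk.injEq, Prod.mk.injEq] at h
  refine Prod.ext (LinearMap.prod_ext ((cotangentDual I m).injective h.1) ?_) h.2.1
  exact LinearMap.ext_ring h.2.2.2

theorem linear_prod_apply {V : Type*} [AddCommGroup V] [Module ℝ V] (L : V × ℝ →ₗ[ℝ] ℝ) (v : V)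
    (r : ℝ) : L (v, r) = L (v, 0) + r * L (0, 1) := by
  have : (v, r) = (v, (0 : ℝ)) + r • ((0, 1) : V × ℝ) := by simp
  rw [this, map_add, map_smul, smul_eq_mul]

variable [IsManifold I ∞ M] [T2Space M] [SigmaCompactSpace M]

/-- The element of `T̃Z` given by an affine function on `PZ`. -/
def derR (σ : ζ.Sec) (m : M) : (ζ.Phase m →ᵃ[ℝ] ℝ) →ₗ[ℝ] ζ.RZ m :=
  (coord σ m).toLinearMap ∘ₗ derCoord I m ∘ₗ (affineCoord (ζ.aff_d σ m)).toLinearMap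

/-- The element of `L̃Z` given by an affine function on `CZ`. -/
def doR (σ : ζ.Sec) (m : M) : (ζ.Contact m →ᵃ[ℝ] ℝ) →ₗ[ℝ] ζ.RZ m :=
  (coord σ m).toLinearMap ∘ₗ doCoord I m ∘ₗ (affineCoord (ζ.aff_c σ m)).toLinearMap

theorem derR_apply (σ : ζ.Sec) {m : M} (D : ζ.Phase m →ᵃ[ℝ] ℝ) : derR σ m D
    = coord σ m (cotangentDual I m D.linear, D (ζ.aff_d σ m), 0, 0) := rfl

theorem doR_apply (σ : ζ.Sec) {m : M} (D : ζ.Contact m →ᵃ[ℝ] ℝ) : doR σ m D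
    = coord σ m (cotangentDual I m (D.linear ∘ₗ LinearMap.inl ℝ _ ℝ), D (ζ.aff_c σ m),
      -D.linear (0, 1), D.linear (0, 1)) := rfl

theorem derR_injective_range (σ : ζ.Sec) (m : M) :
    Function.Injective (derR σ m) ∧ Set.range (derR σ m) = ζ.TTilde m := by
  constructor
  · have h : Function.Injective (derCoord I m) :=
      (cotangentDual I m).injective.prodMap LinearMap.inl_injective
    exact (coord σ m).injective.comp (h.comp (affineCoord _).injective)
  · ext R
    obtain ⟨c, rfl⟩ := (coord σ m).surjective R
    rw [SetLike.mem_coe, coord_mem_TTilde, Submodule.mem_bot]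
    constructor
    · rintro ⟨D, hD⟩
      rw [← (coord σ m).injective hD]
      rfl
    · intro hc
      refine ⟨(affineCoord (ζ.aff_d σ m)).symm ((cotangentDual I m).symm c.1, c.2.1), ?_⟩
      refine congrArg (coord σ m) ?_
      refine (congrArg (derCoord I m) ((affineCoord _).apply_symm_apply _)).trans ?_
      rw [derCoord_apply, LinearEquiv.apply_symm_apply]
      exact Prod.ext rfl (Prod.ext rfl hc.symm)

theorem doR_injective_range (σ : ζ.Sec) (m : M) :
    Function.Injective (doR σ m) ∧ Set.range (doR σ m) = ζ.LTilde m := by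
  constructor
  · exact (coord σ m).injective.comp ((doCoord_injective m).comp (affineCoord _).injective)
  · ext R
    obtain ⟨c, rfl⟩ := (coord σ m).surjective R
    rw [SetLike.mem_coe, coord_mem_LTilde]
    constructor
    · rintro ⟨D, hD⟩
      rw [← (coord σ m).injective hD]
      exact neg_add_cancel _
    · intro hc
      refine ⟨(affineCoord (ζ.aff_c σ m)).symm (((cotangentDual I m).symm c.1).coprod
        (LinearMap.toSpanSingleton ℝ ℝ c.2.2.2), c.2.1), ?_⟩
      refine congrArg (coord σ m) ?_
      refine (congrArg (doCoord I m) ((affineCoord _).apply_symm_apply _)).trans ?_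
      rw [doCoord_apply, LinearMap.coprod_inl, LinearEquiv.apply_symm_apply]
      refine Prod.ext rfl (Prod.ext rfl (Prod.ext ?_ ?_))
      · simpa using (eq_neg_of_add_eq_zero_left hc).symm
      · simp

/-- With `β = γ = 0`, `act_secF` leaves `d(τ - σ)(v) + α`, the expansion of the affine function `D`
around `dσ`. -/
theorem derR_act (σ : ζ.Sec) (D : ∀ m, ζ.Phase m →ᵃ[ℝ] ℝ) (τ : ζ.Sec) (z : Z) :
    D (ζ.proj z) (ζ.aff_d τ (ζ.proj z)) =
      (ζ.toOp fun m => derR σ m (D m)).act (ζ.secF τ.val) z := by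
  have h := (D (ζ.proj z)).linearMap_vsub (ζ.aff_d τ (ζ.proj z)) (ζ.aff_d σ (ζ.proj z))
  rw [aff_d_vsub, vsub_eq_sub] at h
  rw [act_secF σ]
  simp only [derR_apply, coords_coord]
  rw [apply_cotangentDual]
  linear_combination -h

theorem doR_act (σ : ζ.Sec) (D : ∀ m, ζ.Contact m →ᵃ[ℝ] ℝ) (τ : ζ.Sec) (z : Z) :
    D (ζ.proj z) (ζ.aff_c τ (ζ.proj z)) =
      (ζ.toOp fun m => doR σ m (D m)).act (ζ.secF τ.val) z := by
  have h := (D (ζ.proj z)).linearMap_vsub (ζ.aff_c τ (ζ.proj z)) (ζ.aff_c σ (ζ.proj z))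
  rw [aff_c_vsub, vsub_eq_sub, linear_prod_apply] at h
  rw [act_secF σ]
  simp only [doR_apply, coords_coord]
  rw [apply_cotangentDual]
  simp only [LinearMap.comp_apply, LinearMap.inl_apply]
  linear_combination -h

theorem isSmoothPhase_aff_d (τ : ζ.Sec) : ζ.IsSmoothPhase (ζ.aff_d τ) := fun σ =>
  isSmoothForm_mvfderiv (ζ.contMDiff_secDiff τ σ)

theorem isSmoothContact_aff_c (τ : ζ.Sec) : ζ.IsSmoothContact (ζ.aff_c τ) := fun σ =>
  ⟨isSmoothForm_mvfderiv (ζ.contMDiff_secDiff τ σ), ζ.contMDiff_secDiff τ σ⟩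

variable [IsManifold J ∞ Z]

/-- The test sections `dσ` and `d(σ + f)` already detect smoothness of `α` and of `v`. Conversely
`D(α) = (α - dσ)(v) + D(dσ)` pairs a smooth form with a smooth field. -/
theorem mem_ADerR_iff (σ : ζ.Sec) (D : ∀ m, ζ.Phase m →ᵃ[ℝ] ℝ) :
    D ∈ ζ.ADerR ↔ ζ.SmoothOnR Set.univ fun m => derR σ m (D m) := by
  refine Iff.trans ?_ (smoothOnR_coord_iff σ Set.univ _).symm
  constructor
  · intro hD
    have h0 := hD _ (isSmoothPhase_aff_d σ)
    refine ⟨smoothVF_of_dfun fun f hf => ?_, ?_⟩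
    · have h1 := (hD _ (isSmoothPhase_aff_d (ζ.secAdd σ f hf))).sub h0
      refine h1.congr fun m => ?_
      have h := (D m).linearMap_vsub (ζ.aff_d (ζ.secAdd σ f hf) m) (ζ.aff_d σ m)
      rw [aff_d_vsub, secDiff_secAdd, vsub_eq_sub] at h
      exact (apply_cotangentDual _ _).trans h
    · exact contMDiffOn_univ.2 (h0.prodMk_space contMDiff_const)
  · rintro ⟨hV, hc⟩ α hα
    have h0 : ContMDiff I 𝓘(ℝ, ℝ) ∞ fun m => D m (ζ.aff_d σ m) :=
      contDiff_fst.contMDiff.comp (contMDiffOn_univ.1 hc)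
    refine (((hα σ).apply hV).add h0).congr fun m => ?_
    have h := (D m).linearMap_vsub (α m) (ζ.aff_d σ m)
    rw [vsub_eq_sub] at h
    refine (eq_add_of_sub_eq h.symm).trans (congrArg (· + D m (ζ.aff_d σ m)) ?_)
    exact (apply_cotangentDual _ _).symm

theorem mem_ADOR_iff (σ : ζ.Sec) (D : ∀ m, ζ.Contact m →ᵃ[ℝ] ℝ) :
    D ∈ ζ.ADOR ↔ ζ.SmoothOnR Set.univ fun m => doR σ m (D m) := by
  refine Iff.trans ?_ (smoothOnR_coord_iff σ Set.univ _).symm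
  constructor
  · intro hD
    have h0 := hD _ (isSmoothContact_aff_c σ)
    have h1 : ∀ f (hf : ContMDiff I 𝓘(ℝ, ℝ) ∞ f), ContMDiff I 𝓘(ℝ, ℝ) ∞
        fun m => (D m).linear (mvfderiv I f m, f m) := by
      intro f hf
      refine ((hD _ (isSmoothContact_aff_c (ζ.secAdd σ f hf))).sub h0).congr fun m => ?_
      have h := (D m).linearMap_vsub (ζ.aff_c (ζ.secAdd σ f hf) m) (ζ.aff_c σ m)
      rwa [aff_c_vsub, secDiff_secAdd, vsub_eq_sub] at h
    -- The test function `f = 1` has zero differential and isolates `γ`; removing `f γ` from the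
    -- general case then leaves `df(v)`.
    have h2 : ContMDiff I 𝓘(ℝ, ℝ) ∞ fun m => (D m).linear (0, 1) := by
      refine (h1 (fun _ => 1) contMDiff_const).congr fun m => ?_
      rw [mvfderiv_const]
    refine ⟨smoothVF_of_dfun fun f hf => ?_, ?_⟩
    · refine ((h1 f hf).sub (hf.mul h2)).congr fun m => ?_
      refine (apply_cotangentDual _ _).trans ?_
      exact eq_sub_of_add_eq (linear_prod_apply (D m).linear _ _).symm
    · exact contMDiffOn_univ.2 (h0.prodMk_space (h2.neg.prodMk_space h2))
  · rintro ⟨hV, hc⟩ κ hκ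
    have hc := contMDiffOn_univ.1 hc
    have h0 : ContMDiff I 𝓘(ℝ, ℝ) ∞ fun m => D m (ζ.aff_c σ m) := contDiff_fst.contMDiff.comp hc
    have h2 : ContMDiff I 𝓘(ℝ, ℝ) ∞ fun m => (D m).linear (0, 1) :=
      (contDiff_snd.comp contDiff_snd).contMDiff.comp hc
    refine ((((hκ σ).1.apply hV).add ((hκ σ).2.mul h2)).add h0).congr fun m => ?_
    have h := (D m).linearMap_vsub (κ m) (ζ.aff_c σ m)
    rw [vsub_eq_sub, ← Prod.mk.eta (p := κ m -ᵥ ζ.aff_c σ m), linear_prod_apply] at h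
    refine (eq_add_of_sub_eq h.symm).trans (congrArg (· + D m (ζ.aff_c σ m)) ?_)
    refine congrArg (· + _) ?_
    exact (apply_cotangentDual ((D m).linear ∘ₗ LinearMap.inl ℝ _ ℝ) _).symm

end

/-! ### Vector and affine subbundles of `RZ` -/

theorem isVectorSubbundle_of_mem_iff [IsManifold I ∞ M] [IsManifold J ∞ Z] [FiniteDimensional ℝ E]
    (σ : ζ.Sec) (K : Submodule ℝ (ℝ × ℝ × ℝ)) {S : ∀ m, Submodule ℝ (ζ.RZ m)}
    (hS : ∀ m c, coord σ m c ∈ S m ↔ c.2 ∈ K) : ζ.IsVectorSubbundle S := fun m => by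
  obtain ⟨U, hU, hm, k, e, he, -⟩ := exists_frame σ K hS m
  exact ⟨U, hU, hm, k, e, he⟩

theorem isVectorSubbundle_TTilde [IsManifold I ∞ M] [IsManifold J ∞ Z] [FiniteDimensional ℝ E]
    (σ : ζ.Sec) : ζ.IsVectorSubbundle ζ.TTilde :=
  isVectorSubbundle_of_mem_iff σ (LinearMap.ker (LinearMap.snd ℝ ℝ (ℝ × ℝ)))
    fun _ c => coord_mem_TTilde σ c

theorem isVectorSubbundle_LTilde [IsManifold I ∞ M] [IsManifold J ∞ Z] [FiniteDimensional ℝ E]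
    (σ : ζ.Sec) : ζ.IsVectorSubbundle ζ.LTilde :=
  isVectorSubbundle_of_mem_iff σ (LinearMap.ker
    ((LinearMap.fst ℝ ℝ ℝ + LinearMap.snd ℝ ℝ ℝ) ∘ₗ LinearMap.snd ℝ ℝ (ℝ × ℝ)))
    fun _ c => coord_mem_LTilde σ c

theorem isVectorSubbundle_LBreve [IsManifold I ∞ M] [IsManifold J ∞ Z] [FiniteDimensional ℝ E]
    (σ : ζ.Sec) : ζ.IsVectorSubbundle ζ.LBreve :=
  isVectorSubbundle_of_mem_iff σ (LinearMap.ker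
    (LinearMap.snd ℝ ℝ ℝ ∘ₗ LinearMap.snd ℝ ℝ (ℝ × ℝ)))
    fun _ c => coord_mem_LBreve σ c

theorem isVectorBundleR [IsManifold I ∞ M] [IsManifold J ∞ Z] [FiniteDimensional ℝ E]
    (σ : ζ.Sec) : ζ.IsVectorBundleR :=
  exists_frame σ ⊤ fun _ _ => Iff.rfl

theorem isAffineSubbundle_of_mem_iff [IsManifold I ∞ M] [IsManifold J ∞ Z] (σ : ζ.Sec)
    {A : ∀ m, Set (ζ.RZ m)} {S : ∀ m, Submodule ℝ (ζ.RZ m)} (hS : ζ.IsVectorSubbundle S)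
    (hA : ∀ m R, R ∈ A m ↔ R - unitR σ m ∈ S m) : ζ.IsAffineSubbundle A S :=
  ⟨hS, fun _ => ⟨Set.univ, isOpen_univ, trivial, unitR σ, smoothOnR_unitR σ _,
    fun x _ => Set.ext (hA x)⟩⟩

end

end AVBundle

end

theorem mainTheorem8
    {E : Type*} [NormedAddCommGroup E] [NormedSpace ℝ E] [FiniteDimensional ℝ E]
    {H : Type*} [TopologicalSpace H] (I : ModelWithCorners ℝ E H) [I.Boundaryless]
    {F : Type*} [NormedAddCommGroup F] [NormedSpace ℝ F] [FiniteDimensional ℝ F]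
    {G : Type*} [TopologicalSpace G] (J : ModelWithCorners ℝ F G) [J.Boundaryless]
    {M : Type*} [TopologicalSpace M] [ChartedSpace H M] [IsManifold I ∞ M]
    [T2Space M] [SigmaCompactSpace M]
    {Z : Type*} [TopologicalSpace Z] [ChartedSpace G Z] [IsManifold J ∞ Z]
    [T2Space Z] [SigmaCompactSpace Z] [AddAction ℝ Z]
    (ζ : AVBundle I J M Z) :
    -- `RZ` is a vector bundle whose sections are the affine-homogeneous operators
    ζ.IsVectorBundleR ∧ Set.BijOn ζ.toOp (ζ.SecR fun _ => Set.univ) (AVBundle.D1ah J Z) ∧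
    -- the 1-forms `φ⁰` and `φ¹` on `RZ`
    ζ.IsSmoothDual ζ.phi1 ∧ (∃! φ, ζ.IsPhi0 φ) ∧
    -- the five subbundles and their equations
    (ζ.IsVectorSubbundle ζ.TTilde ∧ ζ.IsVectorSubbundle ζ.LTilde ∧ ζ.IsVectorSubbundle ζ.LBreve ∧
      ζ.IsAffineSubbundle ζ.TBar ζ.TTilde ∧ ζ.IsAffineSubbundle ζ.LBar ζ.LTilde) ∧
    (∀ φ0, ζ.IsPhi0 φ0 → ∀ m, ∀ R : ζ.RZ m,
      (R ∈ ζ.TTilde m ↔ φ0 m R = 0 ∧ ζ.phi1 m R = 0) ∧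
      (R ∈ ζ.LTilde m ↔ ζ.phi1 m R - φ0 m R = 0) ∧
      (R ∈ ζ.LBreve m ↔ ζ.phi1 m R = 0) ∧
      (R ∈ ζ.TBar m ↔ φ0 m R = -1 ∧ ζ.phi1 m R = 0) ∧
      (R ∈ ζ.LBar m ↔ ζ.phi1 m R - φ0 m R = 1)) ∧
    -- `Sec(T̃Z)` and `Sec(L̆Z)` as spaces of vector fields
    Set.BijOn ζ.toOp (ζ.SecR fun m => ζ.TTilde m) (AVBundle.Xinv J Z) ∧
    Set.BijOn ζ.toOp (ζ.SecR fun m => ζ.LBreve m) (AVBundle.Xah J Z) ∧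
    -- (a) `ADer(Z) = Sec(T̃Z)`
    (∃ Ψ : ∀ m, (ζ.Phase m →ᵃ[ℝ] ℝ) →ₗ[ℝ] ζ.RZ m,
      (∀ m, Function.Injective (Ψ m) ∧ Set.range (Ψ m) = ζ.TTilde m) ∧
      Set.BijOn (fun D m => Ψ m (D m)) ζ.ADerR (ζ.SecR fun m => ζ.TTilde m) ∧
      ∀ D ∈ ζ.ADerR, ∀ (σ : ζ.Sec) (z : Z),
        D (ζ.proj z) (ζ.aff_d σ (ζ.proj z)) =
          (ζ.toOp fun m => Ψ m (D m)).act (ζ.secF σ.val) z) ∧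
    -- (b) `ADer(Z; Z) = Sec(T̄Z)`
    (∃ Ψ : ∀ m, (ζ.Phase m →ᵃ[ℝ] ζ.Fiber m) →ᵃ[ℝ] ζ.RZ m,
      (∀ m, Function.Injective (Ψ m) ∧ Set.range (Ψ m) = ζ.TBar m) ∧
      Set.BijOn (fun D m => Ψ m (D m)) ζ.ADerZ (ζ.SecR ζ.TBar) ∧
      ∀ D ∈ ζ.ADerZ, ∀ (σ : ζ.Sec) (z : Z),
        ζ.secF (fun m => D m (ζ.aff_d σ m)) z =
          (ζ.toOp fun m => Ψ m (D m)).act (ζ.secF σ.val) z) ∧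
    -- (c) `ADO¹(Z) = Sec(L̃Z)`
    (∃ Ψ : ∀ m, (ζ.Contact m →ᵃ[ℝ] ℝ) →ₗ[ℝ] ζ.RZ m,
      (∀ m, Function.Injective (Ψ m) ∧ Set.range (Ψ m) = ζ.LTilde m) ∧
      Set.BijOn (fun D m => Ψ m (D m)) ζ.ADOR (ζ.SecR fun m => ζ.LTilde m) ∧
      ∀ D ∈ ζ.ADOR, ∀ (σ : ζ.Sec) (z : Z),
        D (ζ.proj z) (ζ.aff_c σ (ζ.proj z)) =
          (ζ.toOp fun m => Ψ m (D m)).act (ζ.secF σ.val) z) ∧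
    -- (d) `ADO¹(Z; Z) = Sec(L̄Z)`
    (∃ Ψ : ∀ m, (ζ.Contact m →ᵃ[ℝ] ζ.Fiber m) →ᵃ[ℝ] ζ.RZ m,
      (∀ m, Function.Injective (Ψ m) ∧ Set.range (Ψ m) = ζ.LBar m) ∧
      Set.BijOn (fun D m => Ψ m (D m)) ζ.ADOZ (ζ.SecR ζ.LBar) ∧
      ∀ D ∈ ζ.ADOZ, ∀ (σ : ζ.Sec) (z : Z),
        ζ.secF (fun m => D m (ζ.aff_c σ m)) z =
          (ζ.toOp fun m => Ψ m (D m)).act (ζ.secF σ.val) z) := by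
  obtain ⟨σ⟩ : Nonempty ζ.Sec := inferInstance
  have hT := AVBundle.isVectorSubbundle_TTilde σ
  have hL := AVBundle.isVectorSubbundle_LTilde σ
  refine ⟨AVBundle.isVectorBundleR σ, AVBundle.bijOn_toOp_D1ah σ, AVBundle.isSmoothDual_phi1 σ,
    AVBundle.existsUnique_isPhi0 σ,
    ⟨hT, hL, AVBundle.isVectorSubbundle_LBreve σ,
      AVBundle.isAffineSubbundle_of_mem_iff σ hT fun _ => AVBundle.mem_TBar_iff σ,
      AVBundle.isAffineSubbundle_of_mem_iff σ hL fun _ => AVBundle.mem_LBar_iff σ⟩,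
    fun φ hφ => AVBundle.mem_subbundles_iff σ hφ,
    AVBundle.bijOn_toOp_Xinv σ, AVBundle.bijOn_toOp_Xah σ,
    ⟨AVBundle.derR σ, AVBundle.derR_injective_range σ,
      AVBundle.bijOn_secR _ _ _ (AVBundle.derR_injective_range σ) (AVBundle.mem_ADerR_iff σ),
      fun D _ => AVBundle.derR_act σ D⟩, ?_,
    ⟨AVBundle.doR σ, AVBundle.doR_injective_range σ,
      AVBundle.bijOn_secR _ _ _ (AVBundle.doR_injective_range σ) (AVBundle.mem_ADOR_iff σ),
      fun D _ => AVBundle.doR_act σ D⟩, ?_⟩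
  · obtain ⟨Ψ, h1, h2, h3⟩ := AVBundle.exists_affine_identification σ ζ.IsSmoothPhase ζ.aff_d
      (fun _ => AVBundle.mem_TBar_iff σ) (AVBundle.derR σ) (AVBundle.derR_injective_range σ)
      (AVBundle.mem_ADerR_iff σ) (AVBundle.derR_act σ)
    exact ⟨Ψ, h1, h2, fun D _ => h3 D⟩
  · obtain ⟨Ψ, h1, h2, h3⟩ := AVBundle.exists_affine_identification σ ζ.IsSmoothContact ζ.aff_c
      (fun _ => AVBundle.mem_LBar_iff σ) (AVBundle.doR σ) (AVBundle.doR_injective_range σ)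
      (AVBundle.mem_ADOR_iff σ) (AVBundle.doR_act σ)
    exact ⟨Ψ, h1, h2, fun D _ => h3 D⟩
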